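/- Let $\mathbf Y$ be a graph of groups whose fundamental group $\Gamma=\pi_1(\mathbf Y)$ is finitely generated, and let $T$ be its Bass–Serre tree; that is, $\Gamma$ acts without inversions on the tree $T$, and the graph of groups induced on the quotient graph $T/\Gamma$ is isomorphic to $\mathbf Y$. Let $\mathcal A$ be the collection of all bi-infinite geodesic lines $\gamma$ of $T$ that admit a cocompact action of an infinite virtually cyclic subgroup of $\Gamma$ (i.e. some infinite virtually cyclic subgroup of $\Gamma$ preserves $\gamma$ and acts cocompactly on it). Let $\widetilde T$ be obtained from (the geometric realization of) $T$ by coning off the lines in $\mathcal A$, i.e. $\widetilde T$ is the homotopy $\Gamma$-pushout (double mapping cylinder) $$\begin{array}{ccc}\bigsqcup_{\gamma\in\mathcal A}\gamma&\longrightarrow& T\\ \downarrow&&\downarrow\\ \bigsqcup_{\gamma\in\mathcal A}\{*_\gamma\}&\longrightarrow&\widetilde T\end{array}$$ of the inclusions $\gamma\to T$ and the collapses $\gamma\to *_\gamma$. A family of subgroups of $\Gamma$ is a non-empty collection of subgroups that is closed under conjugation and under taking subgroups; let $\mathrm{Iso}_\Gamma(\widetilde T)$ be the smallest family that contains all isotropy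 groups of $\widetilde T$. Then $\widetilde T$ is a model for the classifying space $E_{\mathrm{Iso}_\Gamma(\widetilde T)}\Gamma$: it is a $\Gamma$-CW-complex, all its isotropy groups belong to $\mathrm{Iso}_\Gamma(\widetilde T)$, and the fixed point set $\widetilde T^{H}$ is contractible for every $H\in\mathrm{Iso}_\Gamma(\widetilde T)$. Moreover, suppose that the splitting $\Gamma=\pi_1(\mathbf Y)$ is acylindrical, i.e. there is an integer $k\ge 0$ such that every path (without backtracking) of length $k$ in $T$ has finite stabilizer in $\Gamma$. Then for every $n\ge 0$ the family $\mathrm{Iso}_\Gamma(\widetilde T)$ contains the family $\mathcal F_n$ of all subgroups of $\Gamma$ that are virtually $\mathbb Z^r$ (have a finite-index subgroup isomorphic to $\mathbb Z^r$) for some $0\le r\le n$. -/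

import Mathlib

namespace BassSerre

open scoped Pointwise unitInterval

noncomputable section

universe u v w

/-! ## Graphs of groups -/

/-- A graph in the sense of Serre: every geometric edge is a pair `{e, bar e}` of oriented edges. -/
structure SerreGraph where
  Vert : Type u
  Edge : Type v
  org : Edge → Vert
  tgt : Edge → Vert
  bar : Edge → Edge
  bar_bar : ∀ e, bar (bar e) = e
  bar_ne : ∀ e, bar e ≠ e
  org_bar : ∀ e, org (bar e) = tgt e

namespace SerreGraph

/-- Geometric (unoriented) edges: `e` and `bar e` are identified. -/
def GeomEdge (Y : SerreGraph.{u, v}) : Type v :=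
  Quot (fun e e' : Y.Edge => e' = Y.bar e)

/-- The geometric edge underlying an oriented edge. -/
def geom (Y : SerreGraph.{u, v}) (e : Y.Edge) : Y.GeomEdge := Quot.mk _ e

end SerreGraph

/-- A graph of groups on `Y`. The edge groups are indexed by the geometric edges, which is the
requirement that `e` and `bar e` have the same edge group. The monomorphism attached to an oriented
edge goes into the group of its target. -/
structure GraphOfGroups (Y : SerreGraph.{u, v}) where
  vertexGroup : Y.Vert → Type w
  edgeGroup : Y.GeomEdge → Type w
  [vertexGroup_group : ∀ P, Group (vertexGroup P)]
  [edgeGroup_group : ∀ q, Group (edgeGroup q)]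
  edgeMap : ∀ e : Y.Edge, edgeGroup (Y.geom e) →* vertexGroup (Y.tgt e)
  edgeMap_injective : ∀ e, Function.Injective (edgeMap e)

attribute [instance] GraphOfGroups.vertexGroup_group GraphOfGroups.edgeGroup_group

/-! ## Groups acting on trees -/

/-- The action of `Γ` on the vertices is an action on the simple graph `T`. A tree in the sense of
Serre has no loops and no multiple edges, so it is a simple graph; its oriented edges are the darts. -/
class GraphAction (Γ : Type*) {V : Type*} [Group Γ] [MulAction Γ V] (T : SimpleGraph V) :
    Prop where
  smul_adj : ∀ (g : Γ) {x y : V}, T.Adj x y → T.Adj (g • x) (g • y)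

section Action

variable (Γ : Type*) {V : Type*} [Group Γ] [MulAction Γ V] (T : SimpleGraph V) [GraphAction Γ T]

/-- The action on oriented edges. -/
instance dartAction : MulAction Γ T.Dart where
  smul g d := ⟨(g • d.fst, g • d.snd), GraphAction.smul_adj g d.adj⟩
  one_smul d := by
    apply SimpleGraph.Dart.ext
    exact Prod.ext (one_smul Γ d.fst) (one_smul Γ d.snd)
  mul_smul g h d := by
    apply SimpleGraph.Dart.ext
    exact Prod.ext (mul_smul g h d.fst) (mul_smul g h d.snd)

/-- `Γ` acts without inversions: no element reverses an edge. -/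
def WithoutInversions : Prop := ∀ (g : Γ) (d : T.Dart), g • d ≠ d.symm

end Action

/-- A splitting of `Γ` as the fundamental group of the graph of groups `G`, with Bass–Serre tree
`T`: the group `Γ` acts without inversions on the tree `T`, and the graph of groups induced on the
quotient graph is isomorphic to `G`.

The last condition is spelled out by lifts. `liftVert` and `liftEdge` pick one vertex, respectively
one oriented edge, of `T` in every orbit and so identify `Y` with the quotient of `T` by `Γ`.
`vertexHom` and `edgeHom` identify the groups of `G` with the stabilizers of the lifts. The target
of the lift of `e` is the translate by `transl e` of the chosen vertex in its orbit, and the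
monomorphism of the induced graph of groups is the inclusion of stabilizers followed by conjugation
with `(transl e)⁻¹`. -/
structure GraphOfGroups.Splitting {Y : SerreGraph.{u, v}} (G : GraphOfGroups.{u, v, w} Y)
    (Γ : Type*) {V : Type*} [Group Γ] [MulAction Γ V] (T : SimpleGraph V) [GraphAction Γ T] where
  isTree : T.IsTree
  withoutInversions : WithoutInversions Γ T
  liftVert : Y.Vert → V
  existsUnique_vert : ∀ x : V, ∃! P, x ∈ MulAction.orbit Γ (liftVert P)
  liftEdge : Y.Edge → T.Dart
  existsUnique_edge : ∀ d : T.Dart, ∃! e, d ∈ MulAction.orbit Γ (liftEdge e)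
  liftEdge_bar : ∀ e, liftEdge (Y.bar e) = (liftEdge e).symm
  transl : Y.Edge → Γ
  snd_liftEdge : ∀ e, (liftEdge e).snd = transl e • liftVert (Y.tgt e)
  vertexHom : ∀ P, G.vertexGroup P →* Γ
  vertexHom_injective : ∀ P, Function.Injective (vertexHom P)
  range_vertexHom : ∀ P, (vertexHom P).range = MulAction.stabilizer Γ (liftVert P)
  edgeHom : ∀ q, G.edgeGroup q →* Γ
  edgeHom_injective : ∀ q, Function.Injective (edgeHom q)
  range_edgeHom : ∀ e, (edgeHom (Y.geom e)).range = MulAction.stabilizer Γ (liftEdge e)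
  vertexHom_edgeMap : ∀ e a, vertexHom (Y.tgt e) (G.edgeMap e a) =
    (transl e)⁻¹ * edgeHom (Y.geom e) a * transl e

/-- The splitting with Bass–Serre tree `T` is acylindrical: for some `k`, every path (without
backtracking) of length `k` in `T` has a finite stabilizer. -/
def IsAcylindrical (Γ : Type*) {V : Type*} [Group Γ] [MulAction Γ V] (T : SimpleGraph V) : Prop :=
  ∃ k : ℕ, ∀ (x y : V) (p : T.Walk x y), p.IsPath → p.length = k →
    {g : Γ | ∀ z ∈ p.support, g • z = z}.Finite

/-! ## Geometric realization -/

/-- A copy of a type, with the discrete topology. -/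
structure DiscreteCopy (α : Type*) where
  val : α

namespace DiscreteCopy

instance (α : Type*) : TopologicalSpace (DiscreteCopy α) := ⊥

instance (α : Type*) : DiscreteTopology (DiscreteCopy α) := ⟨rfl⟩

instance (Γ α : Type*) [Group Γ] [MulAction Γ α] : MulAction Γ (DiscreteCopy α) where
  smul g x := ⟨g • x.val⟩
  one_smul x := congrArg DiscreteCopy.mk (one_smul Γ x.val)
  mul_smul g h x := congrArg DiscreteCopy.mk (mul_smul g h x.val)

end DiscreteCopy

/-- The gluing relation of the geometric realization on `V ⊔ (E × I)`. -/
inductive RealizationRel {V : Type*} (T : SimpleGraph V) :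
    DiscreteCopy V ⊕ (DiscreteCopy T.Dart × I) → DiscreteCopy V ⊕ (DiscreteCopy T.Dart × I) → Prop
  | symm (d : T.Dart) (t : I) :
      RealizationRel T (Sum.inr (⟨d⟩, t)) (Sum.inr (⟨d.symm⟩, unitInterval.symm t))
  | zero (d : T.Dart) : RealizationRel T (Sum.inr (⟨d⟩, 0)) (Sum.inl ⟨d.fst⟩)
  | one (d : T.Dart) : RealizationRel T (Sum.inr (⟨d⟩, 1)) (Sum.inl ⟨d.snd⟩)

/-- The geometric realization of a graph: the quotient of `V ⊔ (E × I)` by the equivalence relation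
generated by `RealizationRel`, with the quotient topology. -/
def Realization {V : Type*} (T : SimpleGraph V) : Type _ := Quot (RealizationRel T)

namespace Realization

variable {V : Type*} (T : SimpleGraph V)

instance : TopologicalSpace (Realization T) :=
  inferInstanceAs (TopologicalSpace (Quot (RealizationRel T)))

/-- The point of the realization given by a vertex. -/
def vertex (x : V) : Realization T := Quot.mk _ (Sum.inl ⟨x⟩)

/-- The point at parameter `t` of an oriented edge. -/
def edge (d : T.Dart) (t : I) : Realization T := Quot.mk _ (Sum.inr (⟨d⟩, t))

variable (Γ : Type*) [Group Γ] [MulAction Γ V] [GraphAction Γ T]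

/-- The action before gluing. -/
def preSMul (g : Γ) : DiscreteCopy V ⊕ (DiscreteCopy T.Dart × I) →
    DiscreteCopy V ⊕ (DiscreteCopy T.Dart × I) :=
  Sum.map (fun x => g • x) (Prod.map (fun d => g • d) id)

theorem preSMul_rel (g : Γ) (a b : DiscreteCopy V ⊕ (DiscreteCopy T.Dart × I))
    (h : RealizationRel T a b) : RealizationRel T (preSMul T Γ g a) (preSMul T Γ g b) := by
  cases h with
  | symm d t => exact RealizationRel.symm (g • d) t
  | zero d => exact RealizationRel.zero (g • d)
  | one d => exact RealizationRel.one (g • d)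

instance : MulAction Γ (Realization T) where
  smul g := Quot.map (preSMul T Γ g) (preSMul_rel T Γ g)
  one_smul x := by
    induction x using Quot.ind with
    | mk a =>
      refine congrArg (Quot.mk _) ?_
      rcases a with x | ⟨d, t⟩
      · exact congrArg Sum.inl (one_smul Γ x)
      · exact congrArg (fun d' => Sum.inr (d', t)) (one_smul Γ d)
  mul_smul g h x := by
    induction x using Quot.ind with
    | mk a =>
      refine congrArg (Quot.mk _) ?_
      rcases a with x | ⟨d, t⟩
      · exact congrArg Sum.inl (mul_smul g h x)
      · exact congrArg (fun d' => Sum.inr (d', t)) (mul_smul g h d)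

theorem smul_edge (g : Γ) (d : T.Dart) (t : I) : g • edge T d t = edge T (g • d) t := rfl

theorem smul_vertex (g : Γ) (x : V) : g • vertex T x = vertex T (g • x) := rfl

end Realization

/-! ## Geodesic lines with a cocompact action -/

/-- `L` is the vertex set of a (bi-infinite) geodesic line of `T`. -/
def IsGeodesicLine {V : Type*} (T : SimpleGraph V) (L : Set V) : Prop :=
  ∃ f : ℤ → V, (∀ i j, (T.dist (f i) (f j) : ℤ) = |i - j|) ∧ L = Set.range f

/-- The line with vertex set `L`, as a subspace of the realization of `T`: the union of the closed
edges with both end points in `L`. -/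
def lineSupport {V : Type*} (T : SimpleGraph V) (L : Set V) : Set (Realization T) :=
  {p | ∃ (d : T.Dart) (t : I), d.fst ∈ L ∧ d.snd ∈ L ∧ p = Realization.edge T d t}

/-- The subgroup `H` preserves `S` and acts cocompactly on it. -/
def ActsCocompactlyOn {Γ X : Type*} [Group Γ] [MulAction Γ X] [TopologicalSpace X]
    (H : Subgroup Γ) (S : Set X) : Prop :=
  (∀ h ∈ H, h • S = S) ∧ ∃ C : Set X, C ⊆ S ∧ IsCompact C ∧ S ⊆ ⋃ h ∈ H, h • C

/-- The group `H` is virtually cyclic: it has a cyclic subgroup of finite index. -/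
def IsVirtuallyCyclic (H : Type*) [Group H] : Prop :=
  ∃ C : Subgroup H, IsCyclic C ∧ C.FiniteIndex

section Axes

variable (Γ : Type*) {V : Type*} [Group Γ] [MulAction Γ V] (T : SimpleGraph V) [GraphAction Γ T]

/-- `L` is a geodesic line of `T` that admits a cocompact action of an infinite virtually cyclic
subgroup of `Γ`. -/
def IsAxis (L : Set V) : Prop :=
  IsGeodesicLine T L ∧ ∃ H : Subgroup Γ, Infinite H ∧ IsVirtuallyCyclic H ∧
    ActsCocompactlyOn H (lineSupport T L)

/-- The collection of all geodesic lines of `T` that admit a cocompact action of an infinite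
virtually cyclic subgroup of `Γ`. -/
def Axis : Type _ := {L : Set V // IsAxis Γ T L}

variable {Γ}

theorem reachable_smul (g : Γ) {x y : V} (h : T.Reachable x y) :
    T.Reachable (g • x) (g • y) := by
  let φ : T →g T := ⟨fun z => g • z, fun h => GraphAction.smul_adj g h⟩
  exact h.map φ

theorem dist_smul_le (g : Γ) {x y : V} (h : T.Reachable x y) :
    T.dist (g • x) (g • y) ≤ T.dist x y := by
  obtain ⟨p, hp⟩ := h.exists_walk_length_eq_dist
  let φ : T →g T := ⟨fun z => g • z, fun h => GraphAction.smul_adj g h⟩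
  rw [← hp, ← SimpleGraph.Walk.length_map φ p]
  exact SimpleGraph.dist_le _

theorem dist_smul (g : Γ) (x y : V) : T.dist (g • x) (g • y) = T.dist x y := by
  by_cases h : T.Reachable x y
  · refine le_antisymm (dist_smul_le T g h) ?_
    simpa using dist_smul_le T g⁻¹ (reachable_smul T g h)
  · have h2 : ¬ T.Reachable (g • x) (g • y) := fun h2 =>
      h (by simpa using reachable_smul T g⁻¹ h2)
    rw [SimpleGraph.dist_eq_zero_of_not_reachable h,
      SimpleGraph.dist_eq_zero_of_not_reachable h2]

theorem IsGeodesicLine.smul (g : Γ) {L : Set V} (h : IsGeodesicLine T L) :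
    IsGeodesicLine T (g • L) := by
  obtain ⟨f, hf, rfl⟩ := h
  refine ⟨fun i => g • f i, fun i j => ?_, ?_⟩
  · rw [dist_smul, hf]
  · ext x
    simp [Set.mem_smul_set]

theorem smul_lineSupport_subset (g : Γ) (L : Set V) :
    g • lineSupport T L ⊆ lineSupport T (g • L) := by
  rintro _ ⟨_, ⟨d, t, h1, h2, rfl⟩, rfl⟩
  exact ⟨g • d, t, Set.smul_mem_smul_set h1, Set.smul_mem_smul_set h2, rfl⟩

theorem smul_lineSupport (g : Γ) (L : Set V) :
    g • lineSupport T L = lineSupport T (g • L) := by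
  refine (smul_lineSupport_subset T g L).antisymm ?_
  rw [Set.subset_smul_set_iff]
  simpa using smul_lineSupport_subset T g⁻¹ (g • L)

theorem continuous_smul_realization (g : Γ) :
    Continuous (fun p : Realization T => g • p) := by
  refine continuous_quot_lift _ (continuous_quot_mk.comp ?_)
  exact Continuous.sumMap continuous_of_discreteTopology
    (Continuous.prodMap continuous_of_discreteTopology continuous_id)

theorem IsVirtuallyCyclic.of_mulEquiv {H K : Type*} [Group H] [Group K] (e : H ≃* K)
    (h : IsVirtuallyCyclic H) : IsVirtuallyCyclic K := by
  obtain ⟨C, hC, hf⟩ := h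
  refine ⟨C.map (e : H →* K), ?_, ?_⟩
  · exact isCyclic_of_surjective _ (e.subgroupMap C).surjective
  · constructor
    rw [Subgroup.index_map_equiv C e]
    exact hf.index_ne_zero

theorem ActsCocompactlyOn.conj {H : Subgroup Γ} {S : Set (Realization T)}
    (h : ActsCocompactlyOn H S) (g : Γ) :
    ActsCocompactlyOn (H.map (MulAut.conj g).toMonoidHom) (g • S) := by
  obtain ⟨h1, C, hCS, hC, hS⟩ := h
  refine ⟨?_, g • C, Set.smul_set_mono hCS, hC.image (continuous_smul_realization T g), ?_⟩
  · rintro _ ⟨k, hk, rfl⟩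
    simp [smul_smul]
    rw [← smul_smul, h1 k hk]
  · rintro _ ⟨p, hp, rfl⟩
    obtain ⟨k, hk, q, hq, rfl⟩ : ∃ k ∈ H, p ∈ k • C := by simpa using hS hp
    refine Set.mem_biUnion (x := g * k * g⁻¹) ⟨k, hk, rfl⟩ ?_
    refine ⟨g • q, ⟨q, hq, rfl⟩, ?_⟩
    simp [smul_smul]

theorem IsAxis.smul (g : Γ) {L : Set V} (h : IsAxis Γ T L) : IsAxis Γ T (g • L) := by
  obtain ⟨hL, H, hinf, hvc, hco⟩ := h
  have e : H ≃* H.map (MulAut.conj g).toMonoidHom :=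
    H.equivMapOfInjective _ (MulAut.conj g).injective
  refine ⟨hL.smul T g, H.map (MulAut.conj g).toMonoidHom, ?_, hvc.of_mulEquiv e, ?_⟩
  · exact Infinite.of_injective e e.injective
  · rw [← smul_lineSupport]
    exact hco.conj T g

instance : MulAction Γ (Axis Γ T) where
  smul g L := ⟨g • L.1, L.2.smul T g⟩
  one_smul L := Subtype.ext (one_smul Γ L.1)
  mul_smul g h L := Subtype.ext (mul_smul g h L.1)

variable (Γ)

/-- The disjoint union of all the lines in `Axis Γ T`, each with the subspace topology. -/
def AxisUnion : Type _ := Σ L : Axis Γ T, lineSupport T L.1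

instance : TopologicalSpace (AxisUnion Γ T) :=
  inferInstanceAs (TopologicalSpace (Σ L : Axis Γ T, lineSupport T L.1))

/-- An element `g` maps the copy of `L` to the copy of `g • L`. -/
instance : MulAction Γ (AxisUnion Γ T) where
  smul g p := ⟨g • p.1, g • p.2.1, smul_lineSupport_subset T g p.1.1 ⟨_, p.2.2, rfl⟩⟩
  one_smul p := Sigma.subtype_ext (one_smul Γ p.1) (one_smul Γ p.2.1)
  mul_smul g h p := Sigma.subtype_ext (mul_smul g h p.1) (mul_smul g h p.2.1)

/-- The inclusion of each line into the realization of `T`. -/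
def axisInclusion : AxisUnion Γ T →[Γ] Realization T where
  toFun p := p.2.1
  map_smul' _ _ := rfl

/-- The map that collapses each line to its own point. -/
def axisCollapse : AxisUnion Γ T →[Γ] DiscreteCopy (Axis Γ T) where
  toFun p := ⟨p.1⟩
  map_smul' _ _ := rfl

end Axes

/-! ## Homotopy pushouts -/

/-- The gluing relation of the double mapping cylinder of `X ← A → Z`. -/
inductive CylinderRel {A X Z : Type*} (f : A → X) (k : A → Z) :
    X ⊕ (A × I) ⊕ Z → X ⊕ (A × I) ⊕ Z → Prop
  | zero (a : A) : CylinderRel f k (Sum.inr (Sum.inl (a, 0))) (Sum.inl (f a))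
  | one (a : A) : CylinderRel f k (Sum.inr (Sum.inl (a, 1))) (Sum.inr (Sum.inr (k a)))

section HomotopyPushout

variable {Γ A X Z : Type*} [Group Γ] [MulAction Γ A] [MulAction Γ X] [MulAction Γ Z]

/-- The homotopy `Γ`-pushout of equivariant maps `X ← A → Z`, that is their double mapping cylinder
with the quotient topology and the induced action (trivial on the cylinder coordinate). -/
def HomotopyPushout (f : A →[Γ] X) (k : A →[Γ] Z) : Type _ := Quot (CylinderRel f k)

variable (f : A →[Γ] X) (k : A →[Γ] Z)

instance [TopologicalSpace A] [TopologicalSpace X] [TopologicalSpace Z] :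
    TopologicalSpace (HomotopyPushout f k) :=
  inferInstanceAs (TopologicalSpace (Quot (CylinderRel f k)))

/-- The action before gluing. -/
def cylinderSMul (g : Γ) : X ⊕ (A × I) ⊕ Z → X ⊕ (A × I) ⊕ Z :=
  Sum.map (fun x => g • x) (Sum.map (Prod.map (fun a => g • a) id) (fun z => g • z))

theorem cylinderSMul_rel (g : Γ) (a b : X ⊕ (A × I) ⊕ Z) (h : CylinderRel f k a b) :
    CylinderRel f k (cylinderSMul g a) (cylinderSMul g b) := by
  cases h with
  | zero a =>
    have h2 := CylinderRel.zero (f := f) (k := k) (g • a)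
    rw [map_smul] at h2
    exact h2
  | one a =>
    have h2 := CylinderRel.one (f := f) (k := k) (g • a)
    rw [map_smul k] at h2
    exact h2

instance : MulAction Γ (HomotopyPushout f k) where
  smul g := Quot.map (cylinderSMul g) (cylinderSMul_rel f k g)
  one_smul x := by
    induction x using Quot.ind with
    | mk a =>
      refine congrArg (Quot.mk _) ?_
      rcases a with x | ⟨a, t⟩ | z
      · exact congrArg Sum.inl (one_smul Γ x)
      · exact congrArg (fun b => Sum.inr (Sum.inl (b, t))) (one_smul Γ a)
      · exact congrArg (fun b => Sum.inr (Sum.inr b)) (one_smul Γ z)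
  mul_smul g h x := by
    induction x using Quot.ind with
    | mk a =>
      refine congrArg (Quot.mk _) ?_
      rcases a with x | ⟨a, t⟩ | z
      · exact congrArg Sum.inl (mul_smul g h x)
      · exact congrArg (fun b => Sum.inr (Sum.inl (b, t))) (mul_smul g h a)
      · exact congrArg (fun b => Sum.inr (Sum.inr b)) (mul_smul g h z)

end HomotopyPushout

/-- The coned-off tree: the homotopy `Γ`-pushout of the inclusion of the lines in `Axis Γ T` into
`T` and the collapse of each of these lines to its own point. -/
abbrev ConedTree (Γ : Type*) {V : Type*} [Group Γ] [MulAction Γ V] (T : SimpleGraph V)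
    [GraphAction Γ T] : Type _ :=
  HomotopyPushout (axisInclusion Γ T) (axisCollapse Γ T)

/-! ## Families of subgroups and classifying spaces -/

/-- A family of subgroups: non-empty, closed under conjugation and under taking subgroups. -/
structure IsFamily {Γ : Type*} [Group Γ] (F : Set (Subgroup Γ)) : Prop where
  nonempty : F.Nonempty
  conj_mem : ∀ H ∈ F, ∀ g : Γ, H.map (MulAut.conj g).toMonoidHom ∈ F
  mem_of_le : ∀ H ∈ F, ∀ K ≤ H, K ∈ F

/-- The smallest family that contains a given collection of subgroups. -/
def generatedFamily {Γ : Type*} [Group Γ] (S : Set (Subgroup Γ)) : Set (Subgroup Γ) :=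
  {K | ∀ F : Set (Subgroup Γ), IsFamily F → S ⊆ F → K ∈ F}

/-- The family generated by the isotropy groups of a `Γ`-space. -/
def isotropyFamily (Γ X : Type*) [Group Γ] [MulAction Γ X] : Set (Subgroup Γ) :=
  generatedFamily (Set.range fun x : X => MulAction.stabilizer Γ x)

/-- `X` is a `Γ`-CW-complex, for the discrete group `Γ`: it is a CW-complex, `Γ` acts by
homeomorphisms that permute the open cells, and an element that maps an open cell to itself fixes
it pointwise. -/
structure IsGCWComplex (Γ X : Type*) [Group Γ] [TopologicalSpace X] [MulAction Γ X] : Prop where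
  t2Space : T2Space X
  continuous_smul : ∀ g : Γ, Continuous fun x : X => g • x
  exists_cells : ∃ _ : Topology.CWComplex (Set.univ : Set X),
    (∀ (g : Γ) (n : ℕ) (i : Topology.RelCWComplex.cell (Set.univ : Set X) n),
      ∃ j : Topology.RelCWComplex.cell (Set.univ : Set X) n,
        g • Topology.RelCWComplex.openCell n i = Topology.RelCWComplex.openCell n j) ∧
    (∀ (g : Γ) (n : ℕ) (i : Topology.RelCWComplex.cell (Set.univ : Set X) n),
      g • Topology.RelCWComplex.openCell n i = Topology.RelCWComplex.openCell n i →
        ∀ x ∈ Topology.RelCWComplex.openCell n i, g • x = x)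

/-- `X` is a model for the classifying space of `Γ` with respect to the family `F`. -/
structure IsModelFor {Γ : Type*} [Group Γ] (F : Set (Subgroup Γ)) (X : Type*) [TopologicalSpace X]
    [MulAction Γ X] : Prop where
  isFamily : IsFamily F
  isGCWComplex : IsGCWComplex Γ X
  stabilizer_mem : ∀ x : X, MulAction.stabilizer Γ x ∈ F
  contractible : ∀ H ∈ F, ContractibleSpace (MulAction.fixedPoints H X)

/-- The group `H` is virtually `ℤ^r`: it has a subgroup of finite index isomorphic to `ℤ^r`. -/
def IsVirtuallyFreeAbelian (r : ℕ) (H : Type*) [Group H] : Prop :=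
  ∃ A : Subgroup H, A.FiniteIndex ∧ Nonempty (A ≃* Multiplicative (Fin r → ℤ))

/-- The subgroups of `Γ` that are virtually `ℤ^r` for some `0 ≤ r ≤ n`. -/
def virtuallyAbelianFamily (Γ : Type*) [Group Γ] (n : ℕ) : Set (Subgroup Γ) :=
  {H | ∃ r ≤ n, IsVirtuallyFreeAbelian r H}

end

end BassSerre

/-! The family generated by the isotropy groups consists of the subgroups of point stabilizers
(`mem_isotropyFamily_iff`). Contractibility therefore has to be shown for a subgroup `H` that fixes
some point of the coned-off tree, and there are two cases.

Suppose that `H` fixes a vertex `v` of the tree. Every geodesic line has a unique vertex closest to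
`v`, its foot. Sliding each line along itself to its foot and then lowering the cone coordinate
deforms the coned-off tree onto the tree (`deform`), and moving all points along geodesics towards
`v` contracts the tree (`moveTo`). Everything is determined by `v`, so it commutes with `H` and
restricts to the fixed point set (`contractibleSpace_of_fixes_vertex`).

Suppose that `H` fixes no vertex. Without inversions, an element that fixes a point fixes every
vertex with a non-zero barycentric coordinate there, so the points fixed by `H` are cone points.
Hence `H` preserves a line, on which it cannot act by reflections and the identity alone without
fixing a vertex; so it contains an element without fixed vertices (`exists_no_fixed_vertex`). Such
an element preserves only one line (`geodesicLine_unique`), and the fixed point set is a single cone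
point.

The CW-structure is handled by coordinates: barycentric coordinates of vertices and cone heights of
lines are continuous and separate points, and an open cell is the set of points with a prescribed
support. The action of the group on cells is then its action on supports.

For a virtually free abelian `H` with free abelian subgroup `A` of finite index, either all elements
of `A` fix vertices or some `a` in `A` fixes none (`fixes_vertex_or_axis`). In the first case
commuting generators have a common fixed vertex, its `H`-orbit is finite, and `H` fixes a vertex. In
the second case `a` translates a line, and uniqueness of that line makes it invariant under `A` and
then under `H`. So `H` fixes a vertex or a cone point. -/

namespace BassSerre
open scoped Pointwise unitInterval

/-! ### Geodesics and convexity in a tree -/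

section Tree

variable {V : Type*} {T : SimpleGraph V}

/-- `z` lies on the geodesic from `x` to `y`. -/
def Between (T : SimpleGraph V) (x z y : V) : Prop := T.dist x z + T.dist z y = T.dist x y

theorem Between.symm {x z y : V} (h : Between T x z y) : Between T y z x := by
  unfold Between at *
  rw [T.dist_comm (u := y), T.dist_comm (u := z) (v := x), T.dist_comm (u := y) (v := x)]
  omega

theorem Between.of_mem_support (hT : T.IsTree) {x y z : V} (p : T.Walk x y)
    (hp : p.length = T.dist x y) (hz : z ∈ p.support) : Between T x z y := by
  classical
  have h1 := T.dist_le (p.takeUntil z hz)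
  have h2 := T.dist_le (p.dropUntil z hz)
  have h3 : (p.takeUntil z hz).length + (p.dropUntil z hz).length = p.length := by
    rw [← SimpleGraph.Walk.length_append, SimpleGraph.Walk.take_spec]
  have h4 := hT.connected.dist_triangle (u := x) (v := z) (w := y)
  unfold Between
  omega

/-- Geodesics from `x` to `z` and from `z` to `y` concatenate to a walk of minimal length, hence to
a path. Paths in a tree are unique, so this is the path obtained from `p` by removing its detours.
-/
theorem Between.mem_support (hT : T.IsTree) {x y z : V} (h : Between T x z y) (p : T.Walk x y) :
    z ∈ p.support := by
  classical
  obtain ⟨q, hq⟩ := hT.connected.exists_walk_length_eq_dist x z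
  obtain ⟨r, hr⟩ := hT.connected.exists_walk_length_eq_dist z y
  have hl : (q.append r).length = T.dist x y := by
    rw [SimpleGraph.Walk.length_append, hq, hr, h]
  have hpath := (q.append r).isPath_of_length_eq_dist hl
  have := hT.isAcyclic.subsingleton_path x y
  have h2 : q.append r = p.bypass :=
    congrArg Subtype.val (Subsingleton.elim (⟨q.append r, hpath⟩ : T.Path x y) p.toPath)
  apply p.support_bypass_subset_support
  rw [← h2, SimpleGraph.Walk.mem_support_append_iff]
  exact Or.inl q.end_mem_support

/-- A point on a geodesic separates the two end points. -/
theorem Between.separates (hT : T.IsTree) {x y z : V} (h : Between T x z y) (w : V) :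
    Between T x z w ∨ Between T w z y := by
  obtain ⟨q, hq⟩ := hT.connected.exists_walk_length_eq_dist x w
  obtain ⟨r, hr⟩ := hT.connected.exists_walk_length_eq_dist w y
  have := h.mem_support hT (q.append r)
  rw [SimpleGraph.Walk.mem_support_append_iff] at this
  exact this.imp (Between.of_mem_support hT q hq) (Between.of_mem_support hT r hr)

theorem Between.unique (hT : T.IsTree) {x y z z' : V} (h : Between T x z y)
    (h' : Between T x z' y) (hd : T.dist x z = T.dist x z') : z = z' := by
  have h0 := hT.connected.dist_eq_zero_iff (u := z) (v := z')
  have := T.dist_comm (u := z) (v := z')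
  apply h0.1
  rcases h.separates hT z' with h1 | h1 <;> unfold Between at * <;> omega

theorem Between.exists (hT : T.IsTree) (x y : V) {n : ℕ} (hn : n ≤ T.dist x y) :
    ∃ z, Between T x z y ∧ T.dist x z = n := by
  obtain ⟨p, hp⟩ := hT.connected.exists_walk_length_eq_dist x y
  have h1 := T.dist_le (p.take n)
  have h2 := T.dist_le (p.drop n)
  have h4 := hT.connected.dist_triangle (u := x) (v := p.getVert n) (w := y)
  rw [SimpleGraph.Walk.take_length] at h1
  rw [SimpleGraph.Walk.drop_length] at h2
  refine ⟨p.getVert n, ?_, ?_⟩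
  · unfold Between
    omega
  · omega

/-- A vertex of a tree has at most one neighbour that is closer to the root. -/
theorem parent_unique (hT : T.IsTree) {v x y y' : V} (h : T.Adj y x) (h' : T.Adj y' x)
    (hd : T.dist v x = T.dist v y + 1) (hd' : T.dist v x = T.dist v y' + 1) : y = y' := by
  rw [← T.dist_eq_one_iff_adj] at h h'
  refine Between.unique hT (x := v) (y := x) ?_ ?_ (by omega) <;> unfold Between <;> omega

/-- Once a path without backtracking moves away from the root, it keeps doing so. -/
theorem dist_succ_of_ne (hT : T.IsTree) {v x y z : V} (hxy : T.Adj x y) (hyz : T.Adj y z)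
    (hne : x ≠ z) (hd : T.dist v y = T.dist v x + 1) : T.dist v z = T.dist v y + 1 := by
  rcases hT.dist_eq_dist_add_one_of_adj v hyz with h | h
  · exact absurd (parent_unique hT hxy hyz.symm hd h) hne
  · exact h

/-- Local to global: by `dist_succ_of_ne` the distance to the starting vertex keeps growing. This is
how the axis of an element without fixed vertices is recognized as a geodesic. -/
theorem dist_of_nonbacktracking (hT : T.IsTree) {f : ℤ → V} (hadj : ∀ i, T.Adj (f i) (f (i + 1)))
    (hne : ∀ i, f i ≠ f (i + 2)) (i j : ℤ) : (T.dist (f i) (f j) : ℤ) = |i - j| := by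
  have key : ∀ (i : ℤ) (n : ℕ), T.dist (f i) (f (i + n)) = n ∧
      T.dist (f i) (f (i + n + 1)) = n + 1 := by
    intro i n
    induction n with
    | zero => simpa [SimpleGraph.dist_eq_one_iff_adj] using hadj i
    | succ n ih =>
      have h2 := hadj (i + n + 1)
      have h3 := hne (i + n)
      rw [show i + (n : ℤ) + 2 = i + n + 1 + 1 by ring] at h3
      have := dist_succ_of_ne hT (v := f i) (hadj (i + n)) h2 h3 (by omega)
      push_cast
      rw [← add_assoc]
      omega
  rcases le_total i j with h | h
  · obtain ⟨n, rfl⟩ := Int.le.dest h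
    rw [(key i n).1]
    simp
  · obtain ⟨n, rfl⟩ := Int.le.dest h
    rw [T.dist_comm, (key j n).1]
    simp

/-- A set of vertices is convex if it contains the geodesics between its elements. -/
def GeodConvex (T : SimpleGraph V) (S : Set V) : Prop :=
  ∀ x ∈ S, ∀ y ∈ S, ∀ z, Between T x z y → z ∈ S

/-- Strict convexity of the distance to `w`: the vertex `z` separates `w` from `x` or from `y`, and
is strictly closer to `w` than that end point. -/
theorem Between.dist_lt_max (hT : T.IsTree) {x y z : V} (h : Between T x z y) (hx : z ≠ x)
    (hy : z ≠ y) (w : V) : T.dist z w < max (T.dist x w) (T.dist y w) := by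
  have h1 := hT.connected.pos_dist_of_ne hx
  have h2 := hT.connected.pos_dist_of_ne hy
  have := T.dist_comm (u := z) (v := x)
  have := T.dist_comm (u := z) (v := w)
  have := T.dist_comm (u := y) (v := w)
  rcases h.separates hT w with h | h <;> unfold Between at h <;> rw [lt_max_iff] <;> omega

/-- The points of a convex set that minimize the largest distance to the points of a finite set
are pairwise equal or adjacent. -/
theorem eq_or_adj_of_minimizers (hT : T.IsTree) {S : Set V} (hS : GeodConvex T S) {F : Finset V}
    (hF : F.Nonempty) {x y : V} (hx : x ∈ S) (hy : y ∈ S)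
    (hxm : ∀ z ∈ S, F.sup' hF (T.dist x) ≤ F.sup' hF (T.dist z))
    (hym : ∀ z ∈ S, F.sup' hF (T.dist y) ≤ F.sup' hF (T.dist z)) : x = y ∨ T.Adj x y := by
  by_contra! hcon
  obtain ⟨hne, hna⟩ := hcon
  have hd : 1 < T.dist x y := hT.connected.one_lt_dist_of_ne_of_not_adj hne hna
  -- One step from `x` towards `y` is an interior point of the geodesic, and by strict convexity it
  -- would have a smaller radius than the minimum.
  obtain ⟨z, hz, hz1⟩ := Between.exists hT x y (n := 1) (by omega)
  have hzx : z ≠ x := by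
    rintro rfl
    simp at hz1
  have hzy : z ≠ y := by
    rintro rfl
    omega
  have hlt : F.sup' hF (T.dist z) < F.sup' hF (T.dist x) := by
    rw [Finset.sup'_lt_iff]
    intro w hw
    refine (hz.dist_lt_max hT hzx hzy w).trans_le (max_le ?_ ?_)
    · exact Finset.le_sup' (T.dist x) hw
    · exact (Finset.le_sup' (T.dist y) hw).trans (hym x hx)
  exact absurd (hxm z (hS x hx y hy z hz)) (by omega)

end Tree

/-! ### Fixed vertices, invariant lines and translations -/

section TreeAction

variable {Γ V : Type*} [Group Γ] [MulAction Γ V] {T : SimpleGraph V} [GraphAction Γ T]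

theorem Between.smul {x z y : V} (h : Between T x z y) (g : Γ) :
    Between T (g • x) (g • z) (g • y) := by
  unfold Between
  rw [dist_smul, dist_smul, dist_smul, h]

theorem smul_adj_iff (g : Γ) {x y : V} : T.Adj (g • x) (g • y) ↔ T.Adj x y := by
  rw [← T.dist_eq_one_iff_adj, dist_smul, T.dist_eq_one_iff_adj]

theorem WithoutInversions.not_swap (hI : WithoutInversions Γ T) {g : Γ} {x y : V}
    (hadj : T.Adj x y) (hx : g • x = y) (hy : g • y = x) : False :=
  hI g ⟨(x, y), hadj⟩ (SimpleGraph.Dart.ext _ _ (Prod.ext hx hy))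

/-- An element that fixes both ends of a geodesic fixes it pointwise, because its points are
determined by their distance to one end. -/
theorem geodConvex_fixedPoints (hT : T.IsTree) (N : Set Γ) :
    GeodConvex T {x : V | ∀ g ∈ N, g • x = x} := by
  intro x hx y hy z hz g hg
  have h := hz.smul g
  rw [hx g hg, hy g hg] at h
  refine h.unique hT hz ?_
  conv_lhs => rw [← hx g hg]
  exact dist_smul T g x z

/-- A subgroup that preserves a convex set and a finite set of vertices fixes a vertex of the
convex set. -/
theorem exists_fixed_of_preserves (hT : T.IsTree) (hI : WithoutInversions Γ T) {S : Set V}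
    (hS : GeodConvex T S) (hSne : S.Nonempty) {F : Finset V} (hF : F.Nonempty) (K : Subgroup Γ)
    (hKS : ∀ g ∈ K, ∀ x ∈ S, g • x ∈ S) (hKF : ∀ g ∈ K, ∀ x ∈ F, g • x ∈ F) :
    ∃ x ∈ S, ∀ g ∈ K, g • x = x := by
  classical
  -- `R x` is the radius of the smallest ball around `x` that contains `F`. As `K` preserves `F`, it
  -- preserves `R`, and so it permutes the minimizers in `S`, which are pairwise equal or adjacent.
  let R : V → ℕ := fun x => F.sup' hF (T.dist x)
  obtain ⟨x, hx, hxm⟩ : ∃ x ∈ S, ∀ z ∈ S, R x ≤ R z := by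
    obtain ⟨x, hx, h⟩ := (wellFounded_lt (α := ℕ)).has_min (R '' S) (hSne.image R)
    obtain ⟨x, hxS, rfl⟩ := hx
    exact ⟨x, hxS, fun z hz => not_lt.1 (h _ ⟨z, hz, rfl⟩)⟩
  have hR : ∀ g ∈ K, ∀ z, R (g • z) = R z := by
    have hle : ∀ g ∈ K, ∀ z, R (g • z) ≤ R z := by
      intro g hg z
      refine Finset.sup'_le _ _ fun w hw => ?_
      have : T.dist (g • z) w = T.dist z (g⁻¹ • w) := by
        rw [← dist_smul T g z, smul_inv_smul]
      rw [this]
      exact Finset.le_sup' (T.dist z) (hKF _ (K.inv_mem hg) w hw)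
    intro g hg z
    refine (hle g hg z).antisymm ?_
    simpa using hle g⁻¹ (K.inv_mem hg) (g • z)
  have hmin : ∀ g ∈ K, ∀ z ∈ S, R (g • x) ≤ R z := fun g hg z hz => by
    rw [hR g hg]
    exact hxm z hz
  refine ⟨x, hx, fun g hg => ?_⟩
  by_contra hne
  have h1 : T.Adj x (g • x) := (eq_or_adj_of_minimizers hT hS hF hx (hKS g hg x hx) hxm
    (hmin g hg)).resolve_left (Ne.symm hne)
  have h2 := (smul_adj_iff g).2 h1
  -- Either `g` squared fixes `x`, and `g` inverts the edge from `x` to `g • x`, or `x`, `g • x` and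
  -- `g • g • x` form a triangle, which a tree does not contain.
  rcases eq_or_adj_of_minimizers hT hS hF hx (hKS _ (K.mul_mem hg hg) x hx) hxm
    (hmin _ (K.mul_mem hg hg)) with h3 | h3
  · exact hI.not_swap h1 rfl (by rw [smul_smul, ← h3])
  · rw [mul_smul] at h3
    apply hT.dist_ne_of_adj x h2
    rw [T.dist_eq_one_iff_adj.2 h1, T.dist_eq_one_iff_adj.2 h3]

/-- An element that preserves a geodesic line acts on it by a translation or a reflection. -/
theorem smul_geodesic_cases {f : ℤ → V} (hf : ∀ i j, (T.dist (f i) (f j) : ℤ) = |i - j|) {g : Γ}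
    (hg : g • Set.range f ⊆ Set.range f) :
    ∃ c : ℤ, (∀ i, g • f i = f (i + c)) ∨ ∀ i, g • f i = f (c - i) := by
  have h1 : ∀ i, ∃ j, f j = g • f i := fun i => hg ⟨f i, ⟨i, rfl⟩, rfl⟩
  choose s hs using h1
  have hd : ∀ i j, |s i - s j| = |i - j| := fun i j => by
    rw [← hf, hs, hs, dist_smul, hf]
  refine ⟨s 0, ?_⟩
  simp only [← hs]
  have h10 := hd 1 0
  rw [sub_zero, abs_one, abs_eq zero_le_one] at h10
  -- The index map `s` is an isometry of `ℤ`, and its values are determined by their distances to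
  -- the two consecutive integers `s 0` and `s 1`.
  have key : ∀ i, |s i - s 0| = |i - 0| ∧ |s i - s 1| = |i - 1| := fun i => ⟨hd i 0, hd i 1⟩
  simp only [abs_eq_abs] at key
  rcases h10 with h | h
  · exact Or.inl fun i => congrArg f (by have := key i; omega)
  · exact Or.inr fun i => congrArg f (by have := key i; omega)

theorem adj_of_geodesic {f : ℤ → V} (hf : ∀ i j, (T.dist (f i) (f j) : ℤ) = |i - j|) (i : ℤ) :
    T.Adj (f i) (f (i + 1)) := by
  rw [← T.dist_eq_one_iff_adj]
  have := hf i (i + 1)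
  rw [sub_add_cancel_left, abs_neg, abs_one] at this
  exact_mod_cast this

/-- A reflection with odd `c` would have its centre at the midpoint of an edge and would invert that
edge. -/
theorem even_of_reflection (hI : WithoutInversions Γ T) {f : ℤ → V}
    (hf : ∀ i j, (T.dist (f i) (f j) : ℤ) = |i - j|) {g : Γ} {c : ℤ}
    (h : ∀ i, g • f i = f (c - i)) : ∃ k, c = 2 * k := by
  rcases Int.even_or_odd' c with ⟨k, hk | hk⟩
  · exact ⟨k, hk⟩
  · exfalso
    refine hI.not_swap (g := g) (adj_of_geodesic hf k) ?_ ?_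
    · rw [h]; congr 1; omega
    · rw [h]; congr 1; omega

/-- An element without fixed vertices that preserves a geodesic line is a translation of it. -/
theorem exists_translation (hI : WithoutInversions Γ T) {f : ℤ → V}
    (hf : ∀ i j, (T.dist (f i) (f j) : ℤ) = |i - j|) {g : Γ} (hfix : ∀ x : V, g • x ≠ x)
    (hg : g • Set.range f ⊆ Set.range f) : ∃ c : ℤ, c ≠ 0 ∧ ∀ i, g • f i = f (i + c) := by
  obtain ⟨c, h | h⟩ := smul_geodesic_cases hf hg
  · refine ⟨c, ?_, h⟩
    rintro rfl
    exact hfix (f 0) (h 0)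
  · obtain ⟨k, rfl⟩ := even_of_reflection hI hf h
    exact absurd (by rw [h]; congr 1; omega) (hfix (f k))

theorem translation_zpow {f : ℤ → V} {g : Γ} {c : ℤ} (h : ∀ i, g • f i = f (i + c)) (n i : ℤ) :
    g ^ n • f i = f (i + n * c) := by
  induction n generalizing i with
  | zero => simp
  | succ n ih =>
    rw [zpow_add_one, mul_smul, h, ih]
    congr 1
    ring
  | pred n ih =>
    rw [zpow_sub_one, mul_smul, show g⁻¹ • f i = f (i - c) by
      rw [inv_smul_eq_iff, h]; congr 1; ring, ih]
    congr 1
    ring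

/-- Translating `f i` and `f' 0` by the same power of `g` keeps their distance `D`. Far out in both
directions the two lines therefore stay within `D` of each other, and in a tree this forces a point
in the middle of one line to lie on the other. -/
theorem geodesicLine_subset (hT : T.IsTree) (hI : WithoutInversions Γ T) {L L' : Set V}
    (hL : IsGeodesicLine T L) (hL' : IsGeodesicLine T L') {g : Γ} (hfix : ∀ x : V, g • x ≠ x)
    (hg : g • L ⊆ L) (hg' : g • L' ⊆ L') : L ⊆ L' := by
  obtain ⟨f, hf, rfl⟩ := hL
  obtain ⟨f', hf', rfl⟩ := hL'
  obtain ⟨c, hc, h⟩ := exists_translation hI hf hfix hg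
  obtain ⟨c', hc', h'⟩ := exists_translation hI hf' hfix hg'
  rintro _ ⟨i, rfl⟩
  set D := T.dist (f i) (f' 0) with hD
  -- With this exponent the translates of `f i` are further than `D` from `f i`.
  set n : ℤ := D + 1 with hn
  have e1 := translation_zpow h n i
  have e2 := translation_zpow h (-n) i
  have e1' := translation_zpow h' n 0
  have e2' := translation_zpow h' (-n) 0
  have d1 : T.dist (f (i + n * c)) (f' (0 + n * c')) = D := by rw [← e1, ← e1', dist_smul]
  have d2 : T.dist (f (i + -n * c)) (f' (0 + -n * c')) = D := by rw [← e2, ← e2', dist_smul]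
  have hnc : n ≤ |n * c| := by
    rw [abs_mul, abs_of_pos (by omega : 0 < n)]
    nlinarith [Int.one_le_abs hc]
  have f1 := hf i (i + n * c)
  have f2 := hf (i + -n * c) i
  have f3 := hf (i + -n * c) (i + n * c)
  rw [show i - (i + n * c) = -(n * c) by ring, abs_neg] at f1
  rw [show i + -n * c - i = -(n * c) by ring, abs_neg] at f2
  rw [show i + -n * c - (i + n * c) = -(2 * (n * c)) by ring, abs_neg, abs_mul] at f3
  have b0 : Between T (f (i + -n * c)) (f i) (f (i + n * c)) := by
    unfold Between
    zify
    rw [f1, f2, f3]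
    norm_num
    ring
  -- The ends of the geodesic through `f i` are replaced one at a time by points of the second line.
  -- The other alternative in `Between.separates` would put `f i` between two points at distance
  -- `D`, one of which is at distance greater than `D` from it.
  have b1 : Between T (f' (0 + -n * c')) (f i) (f (i + n * c)) := by
    refine (b0.separates hT _).resolve_left fun hb => ?_
    unfold Between at hb
    omega
  have b2 : Between T (f' (0 + -n * c')) (f i) (f' (0 + n * c')) := by
    refine (b1.separates hT _).resolve_right fun hb => ?_
    unfold Between at hb
    rw [T.dist_comm] at d1
    have := T.dist_comm (u := f i) (v := f (i + n * c))
    omega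
  have g3 := hf' (0 + -n * c') (0 + n * c')
  set a := 0 + -n * c'
  set b := 0 + n * c'
  have hle : (T.dist (f' a) (f i) : ℤ) ≤ |a - b| := by
    rw [← g3]
    exact_mod_cast (by unfold Between at b2; omega : T.dist (f' a) (f i) ≤ T.dist (f' a) (f' b))
  set m : ℤ := (T.dist (f' a) (f i) : ℤ) with hm
  -- The index of the point of `f'` between `f' a` and `f' b` at the same distance from `f' a` as `f
  -- i`; it coincides with `f i` by uniqueness.
  obtain ⟨j, hj1, hj2⟩ : ∃ j, |a - j| = m ∧ |a - j| + |j - b| = |a - b| := by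
    rcases le_total a b with hab | hab
    · refine ⟨a + m, ?_, ?_⟩
      · simp [hm]
      · rw [abs_of_nonpos (by omega : a - b ≤ 0)] at *
        rw [abs_of_nonpos (by omega), abs_of_nonpos (by omega)]
        ring
    · refine ⟨a - m, ?_, ?_⟩
      · simp [hm]
      · rw [abs_of_nonneg (by omega : 0 ≤ a - b)] at *
        rw [abs_of_nonneg (by omega), abs_of_nonneg (by omega)]
        ring
  refine ⟨j, ?_⟩
  refine Between.unique hT (x := f' a) (y := f' b) ?_ b2 ?_
  · unfold Between
    zify
    rw [hf', hf', hf', hj2]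
  · zify
    rw [hf', hj1]

/-- A group element without fixed vertices preserves at most one geodesic line. -/
theorem geodesicLine_unique (hT : T.IsTree) (hI : WithoutInversions Γ T) {L L' : Set V}
    (hL : IsGeodesicLine T L) (hL' : IsGeodesicLine T L') {g : Γ} (hfix : ∀ x : V, g • x ≠ x)
    (hg : g • L = L) (hg' : g • L' = L') : L = L' :=
  (geodesicLine_subset hT hI hL hL' hfix hg.le hg'.le).antisymm
    (geodesicLine_subset hT hI hL' hL hfix hg'.le hg.le)

/-- A group element without fixed vertices translates a geodesic line. -/
theorem exists_translated_line (hT : T.IsTree) (hI : WithoutInversions Γ T) {g : Γ}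
    (hfix : ∀ x : V, g • x ≠ x) : ∃ (f : ℤ → V) (n : ℕ), 0 < n ∧
      (∀ i j, (T.dist (f i) (f j) : ℤ) = |i - j|) ∧ ∀ i, g • f i = f (i + n) := by
  have := hT.connected.nonempty
  -- A vertex of minimal displacement. The translates of a geodesic from `x` to `g • x` fit together
  -- to a line, and minimality prevents backtracking where they meet.
  obtain ⟨x, hxm⟩ : ∃ x, ∀ y, T.dist x (g • x) ≤ T.dist y (g • y) :=
    ⟨Function.argmin fun x => T.dist x (g • x), fun y =>
      Function.argmin_le (fun x => T.dist x (g • x)) y⟩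
  obtain ⟨p, hp⟩ := hT.connected.exists_walk_length_eq_dist x (g • x)
  set n := T.dist x (g • x) with hn
  have hpos : 0 < n := hT.connected.pos_dist_of_ne (hfix x).symm
  have hn0 : (n : ℤ) ≠ 0 := by omega
  let f : ℤ → V := fun i => g ^ (i / n) • p.getVert (i % n).toNat
  have hper : ∀ i, g • f i = f (i + n) := fun i => by
    simp only [f]
    rw [Int.add_ediv_of_dvd_right (dvd_refl _), Int.ediv_self hn0, Int.add_emod_right,
      smul_smul, add_comm, zpow_one_add]
  -- The value `r = n` is allowed because the end `g • x` of one translate is the start of the next;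
  -- consecutive vertices can then always be read off a single translate.
  have hval : ∀ (q : ℤ) (r : ℕ), r ≤ n → f (q * n + r) = g ^ q • p.getVert r := by
    intro q r hr
    simp only [f]
    rcases hr.lt_or_eq with hr | hr
    · rw [add_comm, Int.add_mul_ediv_right _ _ hn0, Int.add_mul_emod_self_right,
        Int.ediv_eq_zero_of_lt (by omega) (by omega), Int.emod_eq_of_lt (by omega) (by omega)]
      simp
    · rw [hr, show q * (n : ℤ) + n = (q + 1) * n by ring, Int.mul_ediv_cancel _ hn0, Int.mul_emod_left]
      rw [zpow_add_one, mul_smul, ← hp, SimpleGraph.Walk.getVert_length]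
      simp
  have hdec : ∀ i : ℤ, ∃ (q : ℤ) (r : ℕ), r < n ∧ i = q * n + r := fun i => by
    have := Int.emod_lt_of_pos i (b := n) (by omega)
    have := Int.emod_nonneg i hn0
    refine ⟨i / n, (i % n).toNat, by omega, ?_⟩
    rw [Int.toNat_of_nonneg this, mul_comm, Int.mul_ediv_add_emod]
  have hadj : ∀ i, T.Adj (f i) (f (i + 1)) := by
    intro i
    obtain ⟨q, r, hr, rfl⟩ := hdec i
    rw [hval q r hr.le, show q * (n : ℤ) + r + 1 = q * n + (r + 1 : ℕ) by push_cast; ring,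
      hval q (r + 1) hr, smul_adj_iff]
    exact p.adj_getVert_succ (by omega)
  have hne : ∀ i, f i ≠ f (i + 2) := by
    intro i heq
    obtain ⟨q, r, hr, rfl⟩ := hdec i
    by_cases hr2 : r + 2 ≤ n
    -- Inside one translate, backtracking would provide a shortcut for the geodesic `p`.
    · rw [hval q r hr.le, show q * (n : ℤ) + r + 2 = q * n + (r + 2 : ℕ) by push_cast; ring,
        hval q (r + 2) hr2, smul_left_cancel_iff] at heq
      have h1 := T.dist_le (p.take r)
      have h2 := T.dist_le (p.drop (r + 2))
      have h3 := hT.connected.dist_triangle (u := x) (v := p.getVert r) (w := g • x)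
      rw [SimpleGraph.Walk.take_length] at h1
      rw [SimpleGraph.Walk.drop_length] at h2
      rw [← heq] at h2
      omega
    · have hrn : r + 1 = n := by omega
      have e : q * (n : ℤ) + r + 2 = (q + 1) * n + (1 : ℕ) := by
        rw [← hrn]; push_cast; ring
      rw [e, hval q r hr.le, hval (q + 1) 1 (by omega), zpow_add_one, mul_smul,
        smul_left_cancel_iff] at heq
      -- At a junction backtracking means that `g` maps vertex `1` of `p` to vertex `n - 1`. For `n
      -- > 1` this displacement is at most `n - 2`, against minimality; for `n = 1` the element `g`
      -- inverts the edge from `x` to `g • x`.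
      rcases Nat.lt_or_ge 1 n with h1 | h1
      · have hle := hxm (p.getVert 1)
        rw [← heq] at hle
        have h2 := T.dist_le ((p.drop 1).take (r - 1))
        have e : (p.drop 1).getVert (r - 1) = p.getVert r := by
          rw [SimpleGraph.Walk.drop_getVert]
          congr 1
          omega
        rw [SimpleGraph.Walk.take_length] at h2
        rw [e] at h2
        omega
      · have hn1 : n = 1 := by omega
        have hr0 : r = 0 := by omega
        subst hr0
        have e1 : p.getVert 1 = g • x := by
          rw [show 1 = p.length by omega, SimpleGraph.Walk.getVert_length]
        rw [e1, SimpleGraph.Walk.getVert_zero] at heq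
        refine hI.not_swap (g := g) (x := x) (y := g • x) ?_ rfl heq.symm
        rw [← T.dist_eq_one_iff_adj, ← hn, hn1]
  exact ⟨f, n, hpos, dist_of_nonbacktracking hT hadj hne, hper⟩

end TreeAction

/-! ### Edges in the realization -/

namespace Realization

variable {V : Type*} (T : SimpleGraph V)

theorem edge_symm (d : T.Dart) (t : I) : edge T d.symm t = edge T d (unitInterval.symm t) := by
  have := Quot.sound (RealizationRel.symm (T := T) d (unitInterval.symm t))
  rw [unitInterval.symm_symm] at this
  exact this.symm

theorem edge_zero (d : T.Dart) : edge T d 0 = vertex T d.fst := Quot.sound (RealizationRel.zero d)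

theorem edge_one (d : T.Dart) : edge T d 1 = vertex T d.snd := Quot.sound (RealizationRel.one d)

theorem continuous_edge (d : T.Dart) : Continuous (edge T d) :=
  continuous_quot_mk.comp (continuous_inr.comp (Continuous.prodMk continuous_const continuous_id))

end Realization

/-! ### Axes and virtually free abelian groups -/

section Axes

variable {Γ V : Type*} [Group Γ] [MulAction Γ V] {T : SimpleGraph V} [GraphAction Γ T]

theorem geodesic_injective {f : ℤ → V} (hf : ∀ i j, (T.dist (f i) (f j) : ℤ) = |i - j|) :
    Function.Injective f := by
  intro i j hij
  have := hf i j
  rw [hij, SimpleGraph.dist_self] at this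
  have := abs_eq_zero.1 this.symm
  omega

theorem succ_of_adj_geodesic {f : ℤ → V} (hf : ∀ i j, (T.dist (f i) (f j) : ℤ) = |i - j|) {i j : ℤ}
    (h : T.Adj (f i) (f j)) : j = i + 1 ∨ i = j + 1 := by
  have h1 := hf i j
  rw [T.dist_eq_one_iff_adj.2 h, Nat.cast_one, eq_comm, abs_eq zero_le_one] at h1
  omega

theorem smul_range_of_translation {f : ℤ → V} {g : Γ} {c : ℤ} (h : ∀ i, g • f i = f (i + c)) :
    g • Set.range f = Set.range f := by
  ext x
  constructor
  · rintro ⟨_, ⟨i, rfl⟩, rfl⟩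
    exact ⟨i + c, (h i).symm⟩
  · rintro ⟨i, rfl⟩
    exact ⟨f (i - c), ⟨_, rfl⟩, by simp [h]⟩

/-- A geodesic line that is translated by an element of the group is an axis. -/
theorem isAxis_of_translation {f : ℤ → V} (hf : ∀ i j, (T.dist (f i) (f j) : ℤ) = |i - j|) {g : Γ}
    {n : ℕ} (hn : 0 < n) (h : ∀ i, g • f i = f (i + n)) : IsAxis Γ T (Set.range f) := by
  have hn0 : (n : ℤ) ≠ 0 := by omega
  have hpow : ∀ q i : ℤ, g ^ q • f i = f (i + q * n) := translation_zpow h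
  refine ⟨⟨f, hf, rfl⟩, Subgroup.zpowers g, ?_, ?_, ?_, ?_⟩
  · refine Infinite.of_injective (fun q : ℤ => (⟨g ^ q, q, rfl⟩ : Subgroup.zpowers g)) ?_
    intro q q' hq
    have h1 : g ^ q = g ^ q' := congrArg Subtype.val hq
    have h2 := geodesic_injective hf ((hpow q 0).symm.trans (h1 ▸ hpow q' 0))
    simpa [hn.ne'] using h2
  · exact ⟨⊤, isCyclic_of_surjective _ Subgroup.topEquiv.symm.surjective, inferInstance⟩
  · rintro _ ⟨q, rfl⟩
    rw [smul_lineSupport, smul_range_of_translation (hpow q)]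
  · let D : ℤ → T.Dart := fun i => ⟨(f i, f (i + 1)), adj_of_geodesic hf i⟩
    have hD : ∀ q i : ℤ, g ^ q • D i = D (i + q * n) := fun q i => by
      refine SimpleGraph.Dart.ext _ _ (Prod.ext (hpow q i) ((hpow q (i + 1)).trans ?_))
      change f _ = f _
      congr 1
      ring
    -- A compact fundamental domain: `n` consecutive closed edges, with `n` the translation length.
    refine ⟨⋃ i ∈ Finset.Ico (0 : ℤ) n, Set.range (Realization.edge T (D i)), ?_, ?_, ?_⟩
    · simp only [Set.iUnion_subset_iff]
      rintro i - _ ⟨t, rfl⟩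
      exact ⟨D i, t, ⟨i, rfl⟩, ⟨i + 1, rfl⟩, rfl⟩
    · exact (Finset.Ico (0 : ℤ) n).isCompact_biUnion fun i _ =>
        isCompact_range (Realization.continuous_edge T (D i))
    · rintro _ ⟨d, t, ⟨i, hi⟩, ⟨j, hj⟩, rfl⟩
      obtain ⟨k, s, hk⟩ : ∃ k s, Realization.edge T d t = Realization.edge T (D k) s := by
        have hadj := d.adj
        rw [← hi, ← hj] at hadj
        rcases succ_of_adj_geodesic hf hadj with hij | hij
        · refine ⟨i, t, congrArg (fun d => Realization.edge T d t) ?_⟩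
          refine SimpleGraph.Dart.ext _ _ (Prod.ext hi.symm ?_)
          exact hj.symm.trans (congrArg f hij)
        · refine ⟨j, unitInterval.symm t, ?_⟩
          rw [← Realization.edge_symm]
          refine congrArg (fun d => Realization.edge T d t) ?_
          refine SimpleGraph.Dart.ext _ _ (Prod.ext ?_ hj.symm)
          exact hi.symm.trans (congrArg f hij)
      have h1 := Int.emod_lt_of_pos k (b := n) (by omega)
      have h2 := Int.emod_nonneg k hn0
      refine Set.mem_biUnion (x := g ^ (k / n)) ⟨k / n, rfl⟩
        ⟨Realization.edge T (D (k % n)) s, ?_, ?_⟩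
      · exact Set.mem_biUnion (x := k % n) (by simp [h1, h2]) ⟨s, rfl⟩
      · change g ^ (k / n) • Realization.edge T (D (k % n)) s = _
        rw [hk, Realization.smul_edge, hD, mul_comm, Int.emod_add_mul_ediv]

/-- If `g ^ N` fixed `y`, its powers would move `f 0` by at most twice the distance to `y`, but they
translate `f 0` arbitrarily far. -/
theorem pow_ne_of_translation (hT : T.IsTree) {f : ℤ → V}
    (hf : ∀ i j, (T.dist (f i) (f j) : ℤ) = |i - j|) {g : Γ} {c : ℤ} (hc : c ≠ 0)
    (h : ∀ i, g • f i = f (i + c)) {N : ℕ} (hN : N ≠ 0) (y : V) : g ^ N • y ≠ y := by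
  intro hy
  set k := 2 * T.dist (f 0) y + 1 with hk
  have h1 : (g ^ N) ^ k • y = y := by
    have : g ^ N ∈ MulAction.stabilizer Γ y := hy
    exact pow_mem this k
  have h2 : (g ^ N) ^ k • f 0 = f ((N * k : ℕ) * c) := by
    rw [← pow_mul, ← zpow_natCast, translation_zpow h, zero_add]
  have h3 := dist_smul T ((g ^ N) ^ k) (f 0) y
  rw [h1, h2] at h3
  have h4 := hT.connected.dist_triangle (u := f 0) (v := y) (w := f ((N * k : ℕ) * c))
  rw [T.dist_comm (u := y), h3] at h4
  have h5 := hf 0 ((N * k : ℕ) * c)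
  rw [zero_sub, abs_neg, abs_mul, abs_of_nonneg (by positivity : (0 : ℤ) ≤ ((N * k : ℕ) : ℤ))] at h5
  have h6 : (k : ℤ) ≤ ((N * k : ℕ) : ℤ) * |c| := by
    have h7 : (1 : ℤ) ≤ |c| := Int.one_le_abs hc
    have h8 : (1 : ℤ) ≤ N := by omega
    calc (k : ℤ) = 1 * k * 1 := by ring
      _ ≤ N * k * |c| := by gcongr
      _ = ((N * k : ℕ) : ℤ) * |c| := by push_cast; ring
  omega

/-- Induction on the set. The vertices fixed by `s` form a convex set, which is preserved by the
powers of `b` because `b` commutes with `s`. These powers also preserve a one-point set `{w}`, so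
`exists_fixed_of_preserves` gives a vertex fixed by all. -/
theorem exists_common_fixed (hT : T.IsTree) (hI : WithoutInversions Γ T) (s : Finset Γ)
    (hcomm : ∀ a ∈ s, ∀ b ∈ s, a * b = b * a) (hell : ∀ a ∈ s, ∃ x : V, a • x = x) :
    ∃ x : V, ∀ a ∈ s, a • x = x := by
  classical
  induction s using Finset.induction_on with
  | empty =>
    have := hT.connected.nonempty
    exact ⟨Classical.arbitrary V, by simp⟩
  | insert b s hb ih =>
    obtain ⟨x, hx⟩ := ih (fun a ha c hc => hcomm a (Finset.mem_insert_of_mem ha) c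
      (Finset.mem_insert_of_mem hc)) fun a ha => hell a (Finset.mem_insert_of_mem ha)
    obtain ⟨w, hw⟩ := hell b (Finset.mem_insert_self b s)
    have hle : Subgroup.zpowers b ≤ Subgroup.centralizer (s : Set Γ) := by
      rw [Subgroup.zpowers_le, Subgroup.mem_centralizer_iff]
      intro a ha
      exact hcomm a (Finset.mem_insert_of_mem ha) b (Finset.mem_insert_self b s)
    have hle' : Subgroup.zpowers b ≤ MulAction.stabilizer Γ w := by
      rw [Subgroup.zpowers_le]
      exact hw
    obtain ⟨y, hy, hyb⟩ := exists_fixed_of_preserves hT hI (geodConvex_fixedPoints hT (s : Set Γ))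
      ⟨x, hx⟩ (Finset.singleton_nonempty w) (Subgroup.zpowers b)
      (fun g hg z hz a ha => by
        rw [smul_smul, Subgroup.mem_centralizer_iff.1 (hle hg) a ha, mul_smul, hz a ha])
      (fun g hg z hz => by
        rw [Finset.mem_singleton] at hz ⊢
        rw [hz]
        exact hle' hg)
    refine ⟨y, fun a ha => ?_⟩
    rcases Finset.mem_insert.1 ha with rfl | ha
    · exact hyb _ (Subgroup.mem_zpowers _)
    · exact hy a ha

/-- A virtually free abelian group that acts without inversions on a tree fixes a vertex or
preserves an axis. -/
theorem fixes_vertex_or_axis (hT : T.IsTree) (hI : WithoutInversions Γ T) {H : Subgroup Γ} {r : ℕ}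
    (hH : IsVirtuallyFreeAbelian r H) :
    (∃ x : V, ∀ h ∈ H, h • x = x) ∨ ∃ L : Axis Γ T, ∀ h ∈ H, h • L = L := by
  classical
  obtain ⟨A, hA, ⟨e⟩⟩ := hH
  have hcomm : ∀ a ∈ A, ∀ b ∈ A, a * b = b * a := by
    intro a ha b hb
    have : (⟨a, ha⟩ : A) * ⟨b, hb⟩ = ⟨b, hb⟩ * ⟨a, ha⟩ := by
      apply e.injective
      rw [map_mul, map_mul, mul_comm]
    exact congrArg Subtype.val this
  by_cases hell : ∀ a ∈ A, ∃ x : V, a • x = x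
  · left
    have hfg : Group.FG A := Group.fg_of_surjective (f := e.symm.toMonoidHom) e.symm.surjective
    obtain ⟨s, hs⟩ := (Group.fg_iff_subgroup_fg A).1 hfg
    have hsA : ∀ a ∈ s, a ∈ A := fun a ha => hs ▸ Subgroup.subset_closure ha
    obtain ⟨x, hx⟩ := exists_common_fixed hT hI (s.image H.subtype)
      (by
        simp only [Finset.mem_image]
        rintro _ ⟨a, ha, rfl⟩ _ ⟨b, hb, rfl⟩
        exact congrArg H.subtype (hcomm a (hsA a ha) b (hsA b hb)))
      (by
        simp only [Finset.mem_image]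
        rintro _ ⟨a, ha, rfl⟩
        exact hell a (hsA a ha))
    have hAx : A ≤ MulAction.stabilizer H x := by
      rw [← hs, Subgroup.closure_le]
      exact fun a ha => hx _ (Finset.mem_image_of_mem _ ha)
    -- The stabilizer of `x` in `H` contains `A`, so the `H`-orbit of `x` is finite and serves as
    -- the invariant finite set.
    have := Subgroup.finiteIndex_of_le hAx
    have hfin : (MulAction.orbit H x).Finite :=
      Finite.of_equiv _ (MulAction.orbitEquivQuotientStabilizer H x).symm
    obtain ⟨y, -, hy⟩ := exists_fixed_of_preserves hT hI (S := Set.univ)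
      (fun _ _ _ _ _ _ => Set.mem_univ _) ⟨x, Set.mem_univ x⟩ (F := hfin.toFinset)
      ⟨x, by simp⟩ H (fun _ _ _ _ => Set.mem_univ _)
      (by
        intro g hg y hy
        rw [Set.Finite.mem_toFinset] at hy ⊢
        exact MulAction.mem_orbit_of_mem_orbit (⟨g, hg⟩ : H) hy)
    exact ⟨y, hy⟩
  · right
    push Not at hell
    obtain ⟨a, ha, hfix⟩ := hell
    obtain ⟨f, n, hn, hf, htr⟩ := exists_translated_line hT hI (g := (a : Γ)) hfix
    have haxis := isAxis_of_translation hf hn htr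
    set L := Set.range f with hL
    have haL : (a : Γ) • L = L := smul_range_of_translation htr
    have hAL : ∀ b ∈ A, (b : Γ) • L = L := by
      intro b hb
      -- As `b` commutes with `a`, the line `b • L` is also preserved by `a`.
      refine (geodesicLine_unique hT hI haxis.1 (haxis.1.smul T (b : Γ)) hfix haL ?_).symm
      have := congrArg H.subtype (hcomm a ha b hb)
      simp only [Subgroup.subtype_apply, Subgroup.coe_mul] at this
      rw [smul_smul, this, mul_smul, haL]
    refine ⟨⟨L, haxis⟩, fun h hh => Subtype.ext ?_⟩
    change h • L = L
    -- The subgroup `A` need not be normal, but some power of the conjugate of `a` by `h` lies in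
    -- `A`. That power preserves `L` as an element of `A` and `h • L` as a conjugate of `a ^ N`, and
    -- it has no fixed vertices.
    obtain ⟨N, hN, -, hmem⟩ := Subgroup.exists_pow_mem_of_index_ne_zero hA.index_ne_zero
      ((⟨h, hh⟩ : H) * a * (⟨h, hh⟩ : H)⁻¹)
    have hb : (((⟨h, hh⟩ : H) * a * (⟨h, hh⟩ : H)⁻¹) ^ N : H) = h * (a : Γ) ^ N * h⁻¹ := by
      push_cast
      rw [conj_pow]
    have hbL := hAL _ hmem
    rw [hb] at hbL
    refine (geodesicLine_unique hT hI haxis.1 (haxis.1.smul T h) (g := h * (a : Γ) ^ N * h⁻¹)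
      ?_ hbL ?_).symm
    · intro x hx
      rw [mul_smul, mul_smul] at hx
      exact pow_ne_of_translation hT hf (Int.natCast_ne_zero.2 hn.ne') htr hN.ne' (h⁻¹ • x) (by rw [eq_inv_smul_iff, hx])
    · have haN : (a : Γ) ^ N • L = L := by
        have : (a : Γ) ^ N ∈ MulAction.stabilizer Γ L :=
          pow_mem (MulAction.mem_stabilizer_iff.2 haL) N
        exact this
      rw [mul_smul, inv_smul_smul, mul_smul, haN]

/-- A group that preserves a geodesic line without fixing a vertex contains an element without
fixed vertices. -/
theorem exists_no_fixed_vertex (hT : T.IsTree) (hI : WithoutInversions Γ T) {L : Set V}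
    (hL : IsGeodesicLine T L) {H : Subgroup Γ} (hHL : ∀ h ∈ H, h • L = L)
    (hH : ∀ x : V, ∃ h ∈ H, h • x ≠ x) : ∃ h ∈ H, ∀ x : V, h • x ≠ x := by
  by_contra! hcon
  obtain ⟨f, hf, rfl⟩ := hL
  -- If every element of `H` fixes some vertex, none is a non-trivial translation of the line; only
  -- the identity on the line and reflections at vertices remain.
  have hzero : ∀ h ∈ H, ∀ c : ℤ, (∀ i, h • f i = f (i + c)) → c = 0 := by
    intro h hh c htr
    by_contra hc
    obtain ⟨x, hx⟩ := hcon h hh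
    exact pow_ne_of_translation hT hf hc htr one_ne_zero x (by rwa [pow_one])
  have hcases : ∀ h ∈ H, (∀ i, h • f i = f i) ∨ ∃ k, ∀ i, h • f i = f (2 * k - i) := by
    intro h hh
    obtain ⟨c, htr | hrf⟩ := smul_geodesic_cases hf (hHL h hh).le
    · refine Or.inl fun i => ?_
      rw [htr, hzero h hh c htr, add_zero]
    · obtain ⟨k, rfl⟩ := even_of_reflection hI hf hrf
      exact Or.inr ⟨k, hrf⟩
  -- The product of the reflections at `f k` and `f l` is a translation by `2 * l - 2 * k`, so all
  -- reflections have the same centre and `H` fixes it. Without reflections `H` fixes the whole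
  -- line.
  by_cases hrefl : ∃ h ∈ H, ∃ k, ∀ i, h • f i = f (2 * k - i)
  · obtain ⟨h, hh, k, hk⟩ := hrefl
    obtain ⟨g, hg, hne⟩ := hH (f k)
    rcases hcases g hg with hg' | ⟨l, hl⟩
    · exact hne (hg' k)
    · have := hzero (g * h) (H.mul_mem hg hh) (2 * l - 2 * k) fun i => by
        rw [mul_smul, hk, hl]
        congr 1
        ring
      refine hne ?_
      rw [hl]
      congr 1
      omega
  · obtain ⟨g, hg, hne⟩ := hH (f 0)
    rcases hcases g hg with hg' | hg'
    · exact hne (hg' 0)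
    · exact hrefl ⟨g, hg, hg'⟩

end Axes

/-! ### Barycentric coordinates on the tree -/

noncomputable section

open scoped Classical in
/-- The barycentric coordinate of a vertex. -/
def Realization.hat {V : Type*} (T : SimpleGraph V) (x : V) : Realization T → ℝ :=
  Quot.lift (Sum.elim (fun y => if y.val = x then 1 else 0)
    (fun q => (if q.1.val.fst = x then (1 - q.2 : ℝ) else 0) +
      (if q.1.val.snd = x then (q.2 : ℝ) else 0))) (by
    intro a b h
    cases h with
    | symm d t => simp [add_comm]
    | zero d => simp
    | one d => simp)

namespace Realization

variable {V : Type*} (T : SimpleGraph V)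

theorem continuous_hat (x : V) : Continuous (hat T x) := by
  refine continuous_quot_lift _ (Continuous.sumElim continuous_of_discreteTopology ?_)
  have h1 : Continuous fun q : DiscreteCopy T.Dart × I => (q.2 : ℝ) :=
    continuous_subtype_val.comp continuous_snd
  have h2 : ∀ P : DiscreteCopy T.Dart → ℝ, Continuous fun q : DiscreteCopy T.Dart × I => P q.1 :=
    fun P => (continuous_of_discreteTopology (f := P)).comp continuous_fst
  classical
  have h3 := ((h2 fun d => if d.val.fst = x then 1 else 0).mul
    ((continuous_const (y := (1 : ℝ))).sub h1)).add
    ((h2 fun d => if d.val.snd = x then 1 else 0).mul h1)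
  refine h3.congr fun q => ?_
  simp

open scoped Classical in
theorem hat_vertex (x y : V) : hat T x (vertex T y) = if y = x then 1 else 0 := rfl

open scoped Classical in
theorem hat_edge (x : V) (d : T.Dart) (t : I) : hat T x (edge T d t) =
    (if d.fst = x then (1 - t : ℝ) else 0) + (if d.snd = x then (t : ℝ) else 0) := rfl

theorem hat_edge_snd (d : T.Dart) (t : I) : hat T d.snd (edge T d t) = t := by
  simp [hat_edge, d.adj.ne]

theorem hat_edge_fst (d : T.Dart) (t : I) : hat T d.fst (edge T d t) = 1 - t := by
  simp [hat_edge, d.adj.ne']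

theorem hat_edge_of_ne {x : V} {d : T.Dart} (h1 : d.fst ≠ x) (h2 : d.snd ≠ x) (t : I) :
    hat T x (edge T d t) = 0 := by
  simp [hat_edge, h1, h2]

theorem exists_eq (p : Realization T) :
    (∃ x, p = vertex T x) ∨ ∃ (d : _) (t : I), 0 < (t : ℝ) ∧ (t : ℝ) < 1 ∧ p = edge T d t := by
  induction p using Quot.ind with
  | mk a =>
    rcases a with x | ⟨d, t⟩
    · exact Or.inl ⟨x.val, rfl⟩
    · rcases t.2.1.eq_or_lt with h0 | h0
      · refine Or.inl ⟨d.val.fst, ?_⟩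
        rw [← edge_zero, show (0 : I) = t from Subtype.ext h0]
        rfl
      · rcases t.2.2.eq_or_lt with h1 | h1
        · refine Or.inl ⟨d.val.snd, ?_⟩
          rw [← edge_one, ← show t = (1 : I) from Subtype.ext h1]
          rfl
        · exact Or.inr ⟨d.val, t, h0, h1, rfl⟩

/-- The open sets on which some coordinate is positive cover the realization; local finiteness is
tested on them. -/
theorem exists_hat_pos (p : Realization T) : ∃ x, 0 < hat T x p := by
  rcases exists_eq T p with ⟨x, rfl⟩ | ⟨d, t, h0, -, rfl⟩
  · exact ⟨x, by simp [hat_vertex]⟩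
  · exact ⟨d.snd, by rwa [hat_edge_snd]⟩

end Realization

section

variable {V : Type*} {T : SimpleGraph V}

theorem vertex_mem_lineSupport {L : Set V} (hL : IsGeodesicLine T L) {x : V} (hx : x ∈ L) :
    Realization.vertex T x ∈ lineSupport T L := by
  obtain ⟨f, hf, rfl⟩ := hL
  obtain ⟨i, rfl⟩ := hx
  have hadj := adj_of_geodesic hf i
  exact ⟨⟨(f i, f (i + 1)), hadj⟩, 0, ⟨i, rfl⟩, ⟨i + 1, rfl⟩, (Realization.edge_zero T ⟨(f i, f (i + 1)), hadj⟩).symm⟩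

theorem mem_of_hat_ne_zero {L : Set V} {p : Realization T} (hp : p ∈ lineSupport T L) {x : V}
    (hx : Realization.hat T x p ≠ 0) : x ∈ L := by
  obtain ⟨d, t, h1, h2, rfl⟩ := hp
  by_contra hxL
  refine hx (Realization.hat_edge_of_ne T ?_ ?_ t)
  · rintro rfl
    exact hxL h1
  · rintro rfl
    exact hxL h2

/-- A point of a line is a vertex of the line or an interior point of one of its edges. -/
theorem lineSupport_exists_eq {L : Set V} {p : Realization T} (hp : p ∈ lineSupport T L) :
    (∃ x ∈ L, p = Realization.vertex T x) ∨ ∃ (d : T.Dart) (t : I), d.fst ∈ L ∧ d.snd ∈ L ∧ 0 < (t : ℝ) ∧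
      (t : ℝ) < 1 ∧ p = Realization.edge T d t := by
  rcases Realization.exists_eq T p with ⟨x, rfl⟩ | ⟨d, t, h0, h1, rfl⟩
  · exact Or.inl ⟨x, mem_of_hat_ne_zero hp (by simp [Realization.hat_vertex]), rfl⟩
  · refine Or.inr ⟨d, t, mem_of_hat_ne_zero hp ?_, mem_of_hat_ne_zero hp ?_, h0, h1, rfl⟩
    · rw [Realization.hat_edge_fst]
      linarith
    · rw [Realization.hat_edge_snd]
      exact h0.ne'

/-- A choice of one orientation of every edge. -/
def IsPositive (d : T.Dart) : Prop := Quot.out d.edge = (d.fst, d.snd)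

theorem isPositive_or_symm (d : T.Dart) : IsPositive d ∨ IsPositive d.symm := by
  have h : s((Quot.out d.edge).1, (Quot.out d.edge).2) = s(d.fst, d.snd) := Quot.out_eq d.edge
  unfold IsPositive
  rw [SimpleGraph.Dart.edge_symm]
  exact Sym2.mk_eq_mk_iff.1 h

theorem IsPositive.eq {d d' : T.Dart} (h : IsPositive d) (h' : IsPositive d')
    (he : ({d.fst, d.snd} : Set V) = {d'.fst, d'.snd}) : d = d' := by
  have : d.edge = d'.edge := by
    have h2 := Set.pair_eq_pair_iff.1 he
    change s(d.fst, d.snd) = s(d'.fst, d'.snd)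
    rw [Sym2.eq_iff]
    exact h2
  refine SimpleGraph.Dart.ext _ _ ?_
  unfold IsPositive at h h'
  exact h.symm.trans ((congrArg Quot.out this).trans h')

end

/-! ### Coordinates on the coned-off tree -/

namespace ConedTree

section

variable {Γ : Type*} {V : Type*} [Group Γ] [MulAction Γ V] {T : SimpleGraph V} [GraphAction Γ T]

/-- A point of the tree as a point of the coned-off tree. -/
def base (p : Realization T) : ConedTree Γ T := Quot.mk _ (Sum.inl p)

/-- The vertices of an axis. -/
def _root_.BassSerre.Axis.verts (L : Axis Γ T) : Set V := L.1

/-- An axis as a subspace of the tree. -/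
def _root_.BassSerre.Axis.support (L : Axis Γ T) : Set (Realization T) := lineSupport T L.verts

/-- A point of a line as a point of the disjoint union of the lines. -/
def onLine (L : Axis Γ T) (p : Realization T) (hp : p ∈ L.support) : AxisUnion Γ T := ⟨L, p, hp⟩

theorem onLine_congr (L : Axis Γ T) {p q : Realization T} (h : p = q) (hp : p ∈ L.support)
    (hq : q ∈ L.support) : onLine L p hp = onLine L q hq := by
  subst h
  rfl

theorem continuous_onLine (L : Axis Γ T) :
    Continuous fun p : L.support => onLine L p.1 p.2 :=
  @continuous_sigmaMk (Axis Γ T) (fun L => lineSupport T L.1) _ L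

theorem continuous_axisUnion {X : Type*} [TopologicalSpace X] {f : AxisUnion Γ T → X}
    (h : ∀ L : Axis Γ T, Continuous fun p : L.support => f (onLine L p.1 p.2)) : Continuous f :=
  continuous_sigma h

theorem _root_.BassSerre.Axis.isGeodesicLine (L : Axis Γ T) : IsGeodesicLine T L.verts := L.2.1

theorem _root_.BassSerre.Axis.vertex_mem (L : Axis Γ T) {x : V} (hx : x ∈ L.verts) :
    Realization.vertex T x ∈ L.support := vertex_mem_lineSupport L.isGeodesicLine hx

theorem _root_.BassSerre.Axis.edge_mem (L : Axis Γ T) {d : T.Dart} (h1 : d.fst ∈ L.verts)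
    (h2 : d.snd ∈ L.verts) (t : I) : Realization.edge T d t ∈ L.support := ⟨d, t, h1, h2, rfl⟩

theorem smul_mem_verts (g : Γ) {L : Axis Γ T} {x : V} (hx : x ∈ L.verts) :
    g • x ∈ (g • L).verts := ⟨x, hx, rfl⟩

theorem smul_mem_support (g : Γ) {L : Axis Γ T} {p : Realization T} (hp : p ∈ L.support) :
    g • p ∈ (g • L).support := smul_lineSupport_subset T g L.1 ⟨p, hp, rfl⟩

/-- A point of the cylinder on a line. -/
def cyl (a : AxisUnion Γ T) (t : I) : ConedTree Γ T := Quot.mk _ (Sum.inr (Sum.inl (a, t)))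

/-- The cone point of a line. -/
def apex (L : Axis Γ T) : ConedTree Γ T := Quot.mk _ (Sum.inr (Sum.inr ⟨L⟩))

theorem cyl_zero (L : Axis Γ T) (p : Realization T) (hp : p ∈ L.support) :
    cyl (onLine L p hp) 0 = base p :=
  Quot.sound (CylinderRel.zero (f := axisInclusion Γ T) (k := axisCollapse Γ T) (onLine L p hp))

theorem cyl_one (L : Axis Γ T) (p : Realization T) (hp : p ∈ L.support) :
    cyl (onLine L p hp) 1 = apex L :=
  Quot.sound (CylinderRel.one (f := axisInclusion Γ T) (k := axisCollapse Γ T) (onLine L p hp))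

theorem continuous_base : Continuous (base : Realization T → ConedTree Γ T) :=
  continuous_quot_mk.comp continuous_inl

theorem continuous_cyl : Continuous fun q : AxisUnion Γ T × I => cyl q.1 q.2 :=
  continuous_quot_mk.comp (continuous_inr.comp continuous_inl)

theorem smul_base (g : Γ) (p : Realization T) : g • (base p : ConedTree Γ T) = base (g • p) := rfl

theorem smul_cyl (g : Γ) (L : Axis Γ T) (p : Realization T) (hp : p ∈ L.support) (t : I) :
    g • cyl (onLine L p hp) t = cyl (onLine (g • L) (g • p) (smul_mem_support g hp)) t := rfl

theorem smul_apex (g : Γ) (L : Axis Γ T) : g • apex L = apex (g • L) := rfl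

theorem ind {P : ConedTree Γ T → Prop} (h1 : ∀ p, P (base p)) (h2 : ∀ L p hp t, P (cyl (onLine L p hp) t))
    (h3 : ∀ L, P (apex L)) (p : ConedTree Γ T) : P p := by
  induction p using Quot.ind with
  | mk a =>
    rcases a with x | ⟨a, t⟩ | z
    · exact h1 x
    · exact h2 a.1 a.2.1 a.2.2 t
    · exact h3 z.val

/-- The barycentric coordinate of a vertex of the tree. -/
def bary (x : V) : ConedTree Γ T → ℝ :=
  Quot.lift (Sum.elim (Realization.hat T x)
    (Sum.elim (fun q => (1 - (q.2 : ℝ)) * Realization.hat T x q.1.2.1) (fun _ => 0))) (by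
    intro a b h
    cases h with
    | zero a =>
      simp
      rfl
    | one a => simp)

open scoped Classical in
/-- The cone coordinate in the cone over a line. -/
def height (L : Axis Γ T) : ConedTree Γ T → ℝ :=
  Quot.lift (Sum.elim (fun _ => 0)
    (Sum.elim (fun q => if q.1.1 = L then (q.2 : ℝ) else 0)
      (fun z => if z.val = L then 1 else 0))) (by
    intro a b h
    cases h with
    | zero a => simp
    | one a =>
      simp
      rfl)

theorem bary_base (x : V) (p : Realization T) :
    bary x (base p : ConedTree Γ T) = Realization.hat T x p := rfl

theorem bary_cyl (x : V) (L : Axis Γ T) (p : Realization T) (hp : p ∈ L.support) (t : I) :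
    bary x (cyl (onLine L p hp) t) = (1 - (t : ℝ)) * Realization.hat T x p := rfl

theorem bary_apex (x : V) (L : Axis Γ T) : bary x (apex L) = 0 := rfl

theorem height_base (L : Axis Γ T) (p : Realization T) : height L (base p) = 0 := rfl

open scoped Classical in
theorem height_cyl (L' L : Axis Γ T) (p : Realization T) (hp : p ∈ L.support) (t : I) :
    height L' (cyl (onLine L p hp) t) = if L = L' then (t : ℝ) else 0 := rfl

open scoped Classical in
theorem height_apex (L L' : Axis Γ T) : height L (apex L') = if L' = L then 1 else 0 := rfl

theorem continuous_point : Continuous fun a : AxisUnion Γ T => a.2.1 :=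
  continuous_axisUnion fun _ => continuous_subtype_val

theorem continuous_bary (x : V) : Continuous (bary x : ConedTree Γ T → ℝ) := by
  refine continuous_quot_lift _ (Continuous.sumElim (Realization.continuous_hat T x)
    (Continuous.sumElim ?_ continuous_const))
  have h2 := ((Realization.continuous_hat T x).comp continuous_point).comp
    (continuous_fst : Continuous (Prod.fst : AxisUnion Γ T × I → _))
  exact (continuous_const.sub (continuous_subtype_val.comp continuous_snd)).mul h2

theorem continuous_axis : Continuous fun a : AxisUnion Γ T => (⟨a.1⟩ : DiscreteCopy (Axis Γ T)) :=
  continuous_axisUnion fun L => (continuous_const (y := (⟨L⟩ : DiscreteCopy (Axis Γ T))))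

theorem continuous_height (L : Axis Γ T) : Continuous (height L : ConedTree Γ T → ℝ) := by
  classical
  refine continuous_quot_lift _ (Continuous.sumElim continuous_const
    (Continuous.sumElim ?_ continuous_of_discreteTopology))
  have h1 : Continuous fun a : AxisUnion Γ T => if a.1 = L then (1 : ℝ) else 0 :=
    (continuous_of_discreteTopology (f := fun z : DiscreteCopy (Axis Γ T) =>
      if z.val = L then (1 : ℝ) else 0)).comp continuous_axis
  refine ((h1.comp continuous_fst).mul (continuous_subtype_val.comp continuous_snd)).congr ?_
  intro q
  simp

theorem _root_.BassSerre.Realization.hat_smul (g : Γ) (x : V) (p : Realization T) :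
    Realization.hat T (g • x) (g • p) = Realization.hat T x p := by
  classical
  induction p using Quot.ind with
  | mk a =>
    rcases a with y | ⟨d, t⟩
    · change Realization.hat T (g • x) (Realization.vertex T (g • y.val)) =
        Realization.hat T x (Realization.vertex T y.val)
      simp only [Realization.hat_vertex, smul_left_cancel_iff]
    · change Realization.hat T (g • x) (Realization.edge T (g • d.val) t) =
        Realization.hat T x (Realization.edge T d.val t)
      have h1 : (g • d.val).fst = g • d.val.fst := rfl
      have h2 : (g • d.val).snd = g • d.val.snd := rfl
      simp only [Realization.hat_edge, h1, h2, smul_left_cancel_iff]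

theorem bary_smul (g : Γ) (x : V) (p : ConedTree Γ T) : bary (g • x) (g • p) = bary x p := by
  induction p using ind with
  | h1 p => exact Realization.hat_smul g x p
  | h2 L p hp t => rw [smul_cyl, bary_cyl, bary_cyl, Realization.hat_smul]
  | h3 L => rfl

theorem height_smul (g : Γ) (L : Axis Γ T) (p : ConedTree Γ T) :
    height (g • L) (g • p) = height L p := by
  classical
  induction p using ind with
  | h1 p => rfl
  | h2 L' p hp t =>
    rw [smul_cyl, height_cyl, height_cyl]
    exact if_congr (smul_left_cancel_iff g) rfl rfl
  | h3 L' =>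
    rw [smul_apex, height_apex, height_apex]
    exact if_congr (smul_left_cancel_iff g) rfl rfl

/-- The lines with a non-zero cone coordinate. -/
def lines (p : ConedTree Γ T) : Set (Axis Γ T) := {L | height L p ≠ 0}

/-- The vertices with a non-zero barycentric coordinate. -/
def verts (p : ConedTree Γ T) : Set V := {x | bary x p ≠ 0}

theorem lines_smul (g : Γ) (p : ConedTree Γ T) : lines (g • p) = g • lines p := by
  ext L
  rw [Set.mem_smul_set_iff_inv_smul_mem]
  change height L (g • p) ≠ 0 ↔ height (g⁻¹ • L) p ≠ 0
  rw [← height_smul g (g⁻¹ • L), smul_inv_smul]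

theorem verts_smul (g : Γ) (p : ConedTree Γ T) : verts (g • p) = g • verts p := by
  ext x
  rw [Set.mem_smul_set_iff_inv_smul_mem]
  change bary x (g • p) ≠ 0 ↔ bary (g⁻¹ • x) p ≠ 0
  rw [← bary_smul g (g⁻¹ • x), smul_inv_smul]

end

/-! ### Cells, characteristic maps and their inverses -/

/-- The cells of the coned-off tree. -/
inductive Cell (Γ : Type*) {V : Type*} [Group Γ] [MulAction Γ V] (T : SimpleGraph V)
    [GraphAction Γ T] : ℕ → Type _
  | vertex (x : V) : Cell Γ T 0
  | apex (L : Axis Γ T) : Cell Γ T 0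
  | edge (d : T.Dart) (hd : IsPositive d) : Cell Γ T 1
  | ray (L : Axis Γ T) (x : V) (hx : x ∈ L.verts) : Cell Γ T 1
  | square (L : Axis Γ T) (d : T.Dart) (hd : IsPositive d) (h1 : d.fst ∈ L.verts) (h2 : d.snd ∈ L.verts) :
      Cell Γ T 2

/-- The affine map from `[-1, 1]` to `[0, 1]`. -/
def par (r : ℝ) : I := Set.projIcc 0 1 zero_le_one ((r + 1) / 2)

theorem continuous_par : Continuous par :=
  continuous_projIcc.comp ((continuous_id.add continuous_const).div_const 2)

theorem coe_par {r : ℝ} (h : |r| ≤ 1) : (par r : ℝ) = (r + 1) / 2 := by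
  rw [abs_le] at h
  rw [par, Set.projIcc_of_mem _ (by constructor <;> linarith)]

theorem par_two_mul_sub (t : I) : par (2 * t - 1) = t := by
  apply Subtype.ext
  rw [coe_par]
  · ring
  · rw [abs_le]
    constructor <;> linarith [t.2.1, t.2.2]

theorem par_neg_one : par (-1) = 0 := by simpa using par_two_mul_sub 0

theorem par_one : par 1 = 1 := by
  have := par_two_mul_sub 1
  norm_num at this
  exact this

variable {Γ : Type*} {V : Type*} [Group Γ] [MulAction Γ V] {T : SimpleGraph V} [GraphAction Γ T]

/-- The characteristic maps. -/
def chart : {n : ℕ} → Cell Γ T n → (Fin n → ℝ) → ConedTree Γ T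
  | _, .vertex x, _ => base (Realization.vertex T x)
  | _, .apex L, _ => apex L
  | _, .edge d _, u => base (Realization.edge T d (par (u 0)))
  | _, .ray L x hx, u => cyl (onLine L (Realization.vertex T x) (L.vertex_mem hx)) (par (u 0))
  | _, .square L d _ h1 h2, u => cyl (onLine L (Realization.edge T d (par (u 0)))
      (L.edge_mem h1 h2 _)) (par (u 1))

/-- The inverses of the characteristic maps, in terms of the coordinates. -/
def coords : {n : ℕ} → Cell Γ T n → ConedTree Γ T → (Fin n → ℝ)
  | _, .vertex _, _ => 0
  | _, .apex _, _ => 0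
  | _, .edge d _, p => fun _ => 2 * bary d.snd p - 1
  | _, .ray L _ _, p => fun _ => 2 * height L p - 1
  -- At edge parameter `t` and cone parameter `s` the barycentric coordinate is `(1 - s) * t`; the
  -- quotient recovers `t` and is defined because `s < 1` on the open cell.
  | _, .square L d _ _ _, p => ![2 * (bary d.snd p / (1 - height L p)) - 1, 2 * height L p - 1]

/-- The lines with a non-zero coordinate on an open cell. -/
def cellLines : {n : ℕ} → Cell Γ T n → Set (Axis Γ T)
  | _, .vertex _ => ∅
  | _, .apex L => {L}
  | _, .edge _ _ => ∅
  | _, .ray L _ _ => {L}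
  | _, .square L _ _ _ _ => {L}

/-- The vertices with a non-zero coordinate on an open cell. -/
def cellVerts : {n : ℕ} → Cell Γ T n → Set V
  | _, .vertex x => {x}
  | _, .apex _ => ∅
  | _, .edge d _ => {d.fst, d.snd}
  | _, .ray _ x _ => {x}
  | _, .square _ d _ _ _ => {d.fst, d.snd}

/-- The norm on `Fin n → ℝ` is the sup norm, so balls are cubes and the square over an edge is a
cell with its two parameters as coordinates. -/
theorem abs_lt_of_mem_ball {n : ℕ} {u : Fin n → ℝ} (hu : u ∈ Metric.ball 0 1) (i : Fin n) :
    |u i| < 1 := by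
  rw [Metric.mem_ball, dist_pi_lt_iff one_pos] at hu
  simpa using hu i

theorem mem_ball_of_abs_lt {n : ℕ} {u : Fin n → ℝ} (hu : ∀ i, |u i| < 1) :
    u ∈ Metric.ball 0 1 := by
  rw [Metric.mem_ball, dist_pi_lt_iff one_pos]
  simpa using hu

theorem mem_closedBall_iff {n : ℕ} {u : Fin n → ℝ} :
    u ∈ Metric.closedBall 0 1 ↔ ∀ i, |u i| ≤ 1 := by
  rw [Metric.mem_closedBall, dist_pi_le_iff zero_le_one]
  simp

theorem par_pos {r : ℝ} (h : |r| < 1) : 0 < (par r : ℝ) := by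
  rw [coe_par h.le]
  rw [abs_lt] at h
  linarith

theorem par_lt_one {r : ℝ} (h : |r| < 1) : (par r : ℝ) < 1 := by
  rw [coe_par h.le]
  rw [abs_lt] at h
  linarith

theorem continuous_chart {n : ℕ} (i : Cell Γ T n) : Continuous (chart i) := by
  cases i with
  | vertex x => exact continuous_const
  | apex L => exact continuous_const
  | edge d hd =>
    exact continuous_base.comp ((Realization.continuous_edge T d).comp
      (continuous_par.comp (continuous_apply 0)))
  | ray L x hx =>
    exact continuous_cyl.comp (continuous_const.prodMk (continuous_par.comp (continuous_apply 0)))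
  | square L d hd h1 h2 =>
    have h := (Realization.continuous_edge T d).comp
      (continuous_par.comp (continuous_apply (A := fun _ : Fin 2 => ℝ) 0))
    have h' := (continuous_onLine L).comp (h.subtype_mk fun u => L.edge_mem h1 h2 _)
    exact continuous_cyl.comp (h'.prodMk (continuous_par.comp (continuous_apply 1)))

theorem coords_chart {n : ℕ} (i : Cell Γ T n) {u : Fin n → ℝ} (hu : u ∈ Metric.ball 0 1) :
    coords i (chart i u) = u := by
  have hb := abs_lt_of_mem_ball hu
  cases i with
  | vertex x => exact Subsingleton.elim _ _
  | apex L => exact Subsingleton.elim _ _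
  | edge d hd =>
    ext j
    rw [Subsingleton.elim j 0]
    simp only [coords, chart, bary_base, Realization.hat_edge_snd, coe_par (hb 0).le]
    ring
  | ray L x hx =>
    ext j
    rw [Subsingleton.elim j 0]
    simp only [coords, chart, height_cyl, if_true, coe_par (hb 0).le]
    ring
  | square L d hd h1 h2 =>
    have hlt := par_lt_one (hb 1)
    have e : coords (Cell.square L d hd h1 h2) (chart (Cell.square L d hd h1 h2) u) =
        ![2 * (par (u 0) : ℝ) - 1, 2 * (par (u 1) : ℝ) - 1] := by
      simp only [coords, chart, height_cyl, if_true, bary_cyl, Realization.hat_edge_snd]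
      rw [mul_div_cancel_left₀ _ (by linarith)]
    rw [e, coe_par (hb 0).le, coe_par (hb 1).le]
    ext j
    fin_cases j <;> simp <;> ring

theorem verts_edge (d : T.Dart) {t : I} (h0 : 0 < (t : ℝ)) (h1 : (t : ℝ) < 1) (x : V) :
    Realization.hat T x (Realization.edge T d t) ≠ 0 ↔ x ∈ ({d.fst, d.snd} : Set V) := by
  by_cases hx : x ∈ ({d.fst, d.snd} : Set V)
  · refine iff_of_true ?_ hx
    rcases hx with rfl | rfl
    · rw [Realization.hat_edge_fst]
      linarith
    · rw [Realization.hat_edge_snd]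
      exact h0.ne'
  · refine iff_of_false ?_ hx
    simp only [Set.mem_insert_iff, Set.mem_singleton_iff, not_or] at hx
    exact not_not.2 (Realization.hat_edge_of_ne T (Ne.symm hx.1) (Ne.symm hx.2) t)

theorem verts_vertex (x y : V) :
    Realization.hat T x (Realization.vertex T y) ≠ 0 ↔ x ∈ ({y} : Set V) := by
  simp [Realization.hat_vertex, eq_comm]

theorem lines_chart {n : ℕ} (i : Cell Γ T n) {u : Fin n → ℝ} (hu : u ∈ Metric.ball 0 1) :
    lines (chart i u) = cellLines i := by
  have hb := abs_lt_of_mem_ball hu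
  ext L
  change height L (chart i u) ≠ 0 ↔ _
  cases i with
  | vertex x => simp [chart, cellLines, height_base]
  | apex L => simp [chart, cellLines, height_apex, eq_comm]
  | edge d hd => simp [chart, cellLines, height_base]
  | ray L x hx => simp [chart, cellLines, height_cyl, (par_pos (hb 0)).ne, eq_comm]
  | square L d hd h1 h2 => simp [chart, cellLines, height_cyl, (par_pos (hb 1)).ne, eq_comm]

theorem verts_chart {n : ℕ} (i : Cell Γ T n) {u : Fin n → ℝ} (hu : u ∈ Metric.ball 0 1) :
    verts (chart i u) = cellVerts i := by
  have hb := abs_lt_of_mem_ball hu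
  ext x
  change bary x (chart i u) ≠ 0 ↔ _
  cases i with
  | vertex y => exact verts_vertex (T := T) x y
  | apex L => simp [chart, cellVerts, bary_apex]
  | edge d hd => exact verts_edge d (par_pos (hb 0)) (par_lt_one (hb 0)) x
  | ray L y hy =>
    rw [chart, bary_cyl, mul_ne_zero_iff_left (by linarith [par_lt_one (hb 0)])]
    exact verts_vertex x y
  | square L d hd h1 h2 =>
    rw [chart, bary_cyl, mul_ne_zero_iff_left (by linarith [par_lt_one (hb 1)])]
    exact verts_edge d (par_pos (hb 0)) (par_lt_one (hb 0)) x

theorem pair_ne_singleton (d : T.Dart) (x : V) : ({d.fst, d.snd} : Set V) ≠ {x} := by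
  intro h
  have h1 : d.fst ∈ ({x} : Set V) := h ▸ Set.mem_insert _ _
  have h2 : d.snd ∈ ({x} : Set V) := h ▸ Set.mem_insert_of_mem _ rfl
  exact d.adj.ne (h1.trans h2.symm)

/-- The five kinds of cells are told apart by the numbers of lines and vertices in the support:
(0,1), (1,0), (0,2), (1,1) and (1,2). Within a kind the support determines the cell, since only one
orientation of each edge is used. -/
theorem cell_ext {n m : ℕ} (i : Cell Γ T n) (j : Cell Γ T m) (h1 : cellLines i = cellLines j)
    (h2 : cellVerts i = cellVerts j) :
    (⟨n, i⟩ : Σ n, Cell Γ T n) = ⟨m, j⟩ := by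
  have p1 := fun (d : T.Dart) x => pair_ne_singleton d x
  have p2 := fun (d : T.Dart) x => (pair_ne_singleton d x).symm
  have p3 := fun (L : Axis Γ T) => Set.singleton_ne_empty L
  have p4 := fun (L : Axis Γ T) => (Set.singleton_ne_empty L).symm
  have p5 := fun (x : V) => Set.singleton_ne_empty x
  have p6 := fun (x : V) => (Set.singleton_ne_empty x).symm
  have p7 := fun (d : T.Dart) => (Set.insert_nonempty d.fst {d.snd}).ne_empty
  have p8 := fun (d : T.Dart) => (Set.insert_nonempty d.fst {d.snd}).ne_empty.symm
  cases i <;> cases j <;> simp only [cellLines, cellVerts, p1, p2, p3, p4, p5, p6, p7, p8,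
    Set.singleton_eq_singleton_iff] at h1 h2
  · subst h2; rfl
  · subst h1; rfl
  · rename_i d hd d' hd'
    obtain rfl := hd.eq hd' h2
    rfl
  · subst h1 h2; rfl
  · rename_i L d hd _ _ L' d' hd' _ _
    subst h1
    obtain rfl := hd.eq hd' h2
    rfl

theorem chart_eq_of_coe {n : ℕ} (u : Fin n → I) (h : ∀ i, 0 < (u i : ℝ) ∧ (u i : ℝ) < 1) :
    (fun i => 2 * (u i : ℝ) - 1) ∈ Metric.ball (0 : Fin n → ℝ) 1 := by
  refine mem_ball_of_abs_lt fun i => ?_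
  rw [abs_lt]
  constructor <;> linarith [(h i).1, (h i).2]

/-- Every point lies in an open cell. -/
theorem exists_chart_eq (p : ConedTree Γ T) :
    ∃ (n : ℕ) (i : Cell Γ T n) (u : Fin n → ℝ), u ∈ Metric.ball 0 1 ∧ chart i u = p := by
  have hbase : ∀ p : Realization T, ∃ (n : ℕ) (i : Cell Γ T n) (u : Fin n → ℝ),
      u ∈ Metric.ball 0 1 ∧ chart i u = base p := by
    intro p
    rcases Realization.exists_eq T p with ⟨x, rfl⟩ | ⟨d, t, h0, h1, rfl⟩
    · exact ⟨0, .vertex x, 0, by simp, rfl⟩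
    · rcases isPositive_or_symm d with hd | hd
      · refine ⟨1, .edge d hd, _, chart_eq_of_coe (fun _ => t) fun _ => ⟨h0, h1⟩, ?_⟩
        rw [chart, par_two_mul_sub]
      · refine ⟨1, .edge d.symm hd, _, chart_eq_of_coe (fun _ => unitInterval.symm t) fun _ => ?_,
          ?_⟩
        · simp [h0, h1]
        · rw [chart, par_two_mul_sub, Realization.edge_symm, unitInterval.symm_symm]
  have hapex : ∀ L : Axis Γ T, ∃ (n : ℕ) (i : Cell Γ T n) (u : Fin n → ℝ),
      u ∈ Metric.ball 0 1 ∧ chart i u = apex L := fun L => ⟨0, .apex L, 0, by simp, rfl⟩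
  induction p using ind with
  | h1 p => exact hbase p
  | h3 L => exact hapex L
  | h2 L p hp s =>
    rcases s.2.1.eq_or_lt with hs0 | hs0
    · rw [show s = 0 from Subtype.ext hs0.symm, cyl_zero]
      exact hbase _
    rcases s.2.2.eq_or_lt with hs1 | hs1
    · rw [show s = 1 from Subtype.ext hs1, cyl_one]
      exact hapex _
    rcases lineSupport_exists_eq hp with ⟨x, hx, rfl⟩ | ⟨d, t, hd1, hd2, h0, h1, rfl⟩
    · refine ⟨1, .ray L x hx, _, chart_eq_of_coe (fun _ => s) fun _ => ⟨hs0, hs1⟩, ?_⟩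
      rw [chart, par_two_mul_sub]
    · rcases isPositive_or_symm d with hd | hd
      · refine ⟨2, .square L d hd hd1 hd2, _, chart_eq_of_coe ![t, s] fun j => ?_, ?_⟩
        · fin_cases j
          · exact ⟨h0, h1⟩
          · exact ⟨hs0, hs1⟩
        · simp only [chart, par_two_mul_sub]
          rfl
      · refine ⟨2, .square L d.symm hd hd2 hd1, _, chart_eq_of_coe ![unitInterval.symm t, s]
          fun j => ?_, ?_⟩
        · fin_cases j
          · simp [h0, h1]
          · exact ⟨hs0, hs1⟩
        · simp only [chart, par_two_mul_sub, Realization.edge_symm]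
          simp

theorem coords_congr {n : ℕ} (i : Cell Γ T n) {p q : ConedTree Γ T}
    (h1 : ∀ L, height L p = height L q) (h2 : ∀ x, bary x p = bary x q) :
    coords i p = coords i q := by
  cases i <;> simp [coords, h1, h2]

/-- The coordinates separate the points. -/
theorem ext_coords {p q : ConedTree Γ T} (h1 : ∀ L, height L p = height L q)
    (h2 : ∀ x, bary x p = bary x q) : p = q := by
  obtain ⟨n, i, u, hu, rfl⟩ := exists_chart_eq p
  obtain ⟨m, j, w, hw, rfl⟩ := exists_chart_eq q
  have e1 : cellLines i = cellLines j := by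
    rw [← lines_chart i hu, ← lines_chart j hw]
    simp [lines, h1]
  have e2 : cellVerts i = cellVerts j := by
    rw [← verts_chart i hu, ← verts_chart j hw]
    simp [verts, h2]
  have e := cell_ext i j e1 e2
  obtain ⟨rfl, e⟩ := Sigma.mk.inj e
  obtain rfl := eq_of_heq e
  have := coords_congr i h1 h2
  rw [coords_chart i hu, coords_chart i hw] at this
  rw [this]

/-- The coordinates are continuous real functions that separate points. -/
instance : T2Space (ConedTree Γ T) := by
  refine ⟨fun p q hne => ?_⟩
  have : (∃ L, height L p ≠ height L q) ∨ ∃ x, bary x p ≠ bary x q := by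
    by_contra! h
    exact hne (ext_coords h.1 h.2)
  rcases this with ⟨L, h⟩ | ⟨x, h⟩
  · exact separated_by_continuous (continuous_height L) h
  · exact separated_by_continuous (continuous_bary x) h

end ConedTree

/-! ### Closed cells, the weak topology and the equivariant CW-structure -/

namespace ConedTree

variable {Γ : Type*} {V : Type*} [Group Γ] [MulAction Γ V] {T : SimpleGraph V} [GraphAction Γ T]

/-- The closed cell of an index. -/
def closedCell {n : ℕ} (i : Cell Γ T n) : Set (ConedTree Γ T) := chart i '' Metric.closedBall 0 1

theorem vertex_mem_closedCell (x : V) :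
    (base (Realization.vertex T x) : ConedTree Γ T) ∈ closedCell (.vertex x : Cell Γ T 0) :=
  ⟨0, by simp, rfl⟩

theorem apex_mem_closedCell (L : Axis Γ T) : apex L ∈ closedCell (.apex L) := ⟨0, by simp, rfl⟩

theorem mem_closedBall_of_coe {n : ℕ} (u : Fin n → I) :
    (fun i => 2 * (u i : ℝ) - 1) ∈ Metric.closedBall (0 : Fin n → ℝ) 1 := by
  refine mem_closedBall_iff.2 fun i => ?_
  rw [abs_le]
  constructor <;> linarith [(u i).2.1, (u i).2.2]

theorem edge_mem_closedCell (d : T.Dart) (hd : IsPositive d) (t : I) :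
    (base (Realization.edge T d t) : ConedTree Γ T) ∈ closedCell (.edge d hd : Cell Γ T 1) :=
  ⟨_, mem_closedBall_of_coe fun _ => t, by rw [chart, par_two_mul_sub]⟩

theorem ray_mem_closedCell (L : Axis Γ T) {x : V} (hx : x ∈ L.verts) (t : I) :
    cyl (onLine L (Realization.vertex T x) (L.vertex_mem hx)) t ∈ closedCell (.ray L x hx) :=
  ⟨_, mem_closedBall_of_coe fun _ => t, by rw [chart, par_two_mul_sub]⟩

theorem square_mem_closedCell (L : Axis Γ T) {d : T.Dart} (hd : IsPositive d)
    (h1 : d.fst ∈ L.verts) (h2 : d.snd ∈ L.verts) (t s : I) :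
    cyl (onLine L (Realization.edge T d t) (L.edge_mem h1 h2 t)) s ∈
      closedCell (.square L d hd h1 h2) := by
  refine ⟨_, mem_closedBall_of_coe ![t, s], ?_⟩
  simp only [chart, par_two_mul_sub]
  rfl

/-- The boundary of a cell is covered by finitely many cells of smaller dimension. -/
theorem exists_boundary {n : ℕ} (i : Cell Γ T n) : ∃ s : Finset (Σ m, Cell Γ T m),
    ∀ u ∈ Metric.sphere (0 : Fin n → ℝ) 1, ∃ j ∈ s, j.1 < n ∧ chart i u ∈ closedCell j.2 := by
  classical
  -- The sphere of the sup norm is the boundary of a cube, so some coordinate is extremal.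
  have key : ∀ u ∈ Metric.sphere (0 : Fin n → ℝ) 1, ∃ j, u j = -1 ∨ u j = 1 := by
    intro u hu
    by_contra! hcon
    have hle := mem_closedBall_iff.1 (Metric.sphere_subset_closedBall hu)
    have : u ∈ Metric.ball 0 1 := mem_ball_of_abs_lt fun j => by
      refine lt_of_le_of_ne (hle j) fun h => ?_
      rcases (abs_eq zero_le_one).1 h with h | h
      · exact (hcon j).2 h
      · exact (hcon j).1 h
    rw [Metric.mem_sphere] at hu
    rw [Metric.mem_ball] at this
    exact this.ne hu
  cases i with
  | vertex x => exact ⟨∅, fun u hu => (key u hu).choose.elim0⟩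
  | apex L => exact ⟨∅, fun u hu => (key u hu).choose.elim0⟩
  | edge d hd =>
    refine ⟨{⟨0, .vertex d.fst⟩, ⟨0, .vertex d.snd⟩}, fun u hu => ?_⟩
    obtain ⟨j, hj⟩ := key u hu
    rw [Subsingleton.elim j 0] at hj
    rcases hj with hj | hj
    · refine ⟨⟨0, .vertex d.fst⟩, by simp, one_pos, ?_⟩
      rw [chart, hj, par_neg_one, Realization.edge_zero]
      exact vertex_mem_closedCell _
    · refine ⟨⟨0, .vertex d.snd⟩, by simp, one_pos, ?_⟩
      rw [chart, hj, par_one, Realization.edge_one]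
      exact vertex_mem_closedCell _
  | ray L x hx =>
    refine ⟨{⟨0, .vertex x⟩, ⟨0, .apex L⟩}, fun u hu => ?_⟩
    obtain ⟨j, hj⟩ := key u hu
    rw [Subsingleton.elim j 0] at hj
    rcases hj with hj | hj
    · refine ⟨⟨0, .vertex x⟩, by simp, one_pos, ?_⟩
      rw [chart, hj, par_neg_one, cyl_zero]
      exact vertex_mem_closedCell _
    · refine ⟨⟨0, .apex L⟩, by simp, one_pos, ?_⟩
      rw [chart, hj, par_one, cyl_one]
      exact apex_mem_closedCell _
  | square L d hd h1 h2 =>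
    -- The two sides of the square are rays, the bottom is the edge in the tree, and the top is
    -- collapsed to the cone point.
    refine ⟨{⟨0, .apex L⟩, ⟨1, .edge d hd⟩, ⟨1, .ray L d.fst h1⟩, ⟨1, .ray L d.snd h2⟩},
      fun u hu => ?_⟩
    obtain ⟨j, hj⟩ := key u hu
    fin_cases j
    · rcases hj with hj | hj
      · refine ⟨⟨1, .ray L d.fst h1⟩, by simp, one_lt_two, ?_⟩
        have e : chart (.square L d hd h1 h2) u =
            cyl (onLine L (Realization.vertex T d.fst) (L.vertex_mem h1)) (par (u 1)) := by
          rw [chart]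
          congr 2
          change u 0 = -1 at hj
          rw [hj, par_neg_one, Realization.edge_zero]
        rw [e]
        exact ray_mem_closedCell L h1 _
      · refine ⟨⟨1, .ray L d.snd h2⟩, by simp, one_lt_two, ?_⟩
        have e : chart (.square L d hd h1 h2) u =
            cyl (onLine L (Realization.vertex T d.snd) (L.vertex_mem h2)) (par (u 1)) := by
          rw [chart]
          congr 2
          change u 0 = 1 at hj
          rw [hj, par_one, Realization.edge_one]
        rw [e]
        exact ray_mem_closedCell L h2 _
    · rcases hj with hj | hj
      · refine ⟨⟨1, .edge d hd⟩, by simp, one_lt_two, ?_⟩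
        change u 1 = -1 at hj
        rw [chart, hj, par_neg_one, cyl_zero]
        exact edge_mem_closedCell _ _ _
      · refine ⟨⟨0, .apex L⟩, by simp, two_pos, ?_⟩
        change u 1 = 1 at hj
        rw [chart, hj, par_one, cyl_one]
        exact apex_mem_closedCell _

theorem isClosed_of_slices {D Y : Type*} [TopologicalSpace D] [DiscreteTopology D]
    [TopologicalSpace Y] {S : Set (D × Y)} (h : ∀ d, IsClosed {y | (d, y) ∈ S}) : IsClosed S := by
  rw [← isOpen_compl_iff]
  have : Sᶜ = ⋃ d, {d} ×ˢ {y | (d, y) ∈ S}ᶜ := by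
    ext ⟨d, y⟩
    simp
  rw [this]
  exact isOpen_iUnion fun d => (isOpen_discrete _).prod (h d).isOpen_compl

/-- The points of a graph that have no other vertices in their support than the end points of a
given edge. -/
def edgeLocus (T : SimpleGraph V) (d : T.Dart) : Set (Realization T) :=
  {p | ∀ x, x ≠ d.fst → x ≠ d.snd → Realization.hat T x p = 0}

theorem isClosed_edgeLocus (d : T.Dart) : IsClosed (edgeLocus T d) := by
  simp only [edgeLocus, Set.ofPred_forall]
  exact isClosed_iInter fun x => isClosed_iInter fun _ => isClosed_iInter fun _ =>
    isClosed_eq (Realization.continuous_hat T x) continuous_const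

theorem edge_mem_edgeLocus (d : T.Dart) (t : I) : Realization.edge T d t ∈ edgeLocus T d :=
  fun _ h1 h2 => Realization.hat_edge_of_ne T h1.symm h2.symm t

/-- A vertex of a line has only two neighbours on the line. This makes the squares over one line
locally finite, although the tree itself need not be locally finite. -/
theorem finite_darts (L : Axis Γ T) (x : V) :
    {d : T.Dart | d.fst ∈ L.verts ∧ d.snd ∈ L.verts ∧ (x = d.fst ∨ x = d.snd)}.Finite := by
  by_cases hx : x ∈ L.verts
  · obtain ⟨f, hf, hL⟩ := L.isGeodesicLine
    rw [hL] at hx ⊢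
    obtain ⟨i, rfl⟩ := hx
    have hfin : (f '' {i - 1, i, i + 1}).Finite := (by simp : Set.Finite _).image f
    refine ((hfin.prod hfin).preimage (f := fun d : T.Dart => d.toProd) ?_).subset ?_
    · intro d _ d' _ h
      exact SimpleGraph.Dart.ext _ _ h
    · rintro d ⟨⟨j, hj⟩, ⟨k, hk⟩, hx⟩
      have hadj := d.adj
      rw [← hj, ← hk] at hadj
      have hjk := succ_of_adj_geodesic hf hadj
      have : i = j ∨ i = k := by
        rw [← hj, ← hk] at hx
        exact hx.imp (fun h => geodesic_injective hf h) fun h => geodesic_injective hf h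
      refine ⟨⟨j, ?_, hj⟩, ⟨k, ?_, hk⟩⟩ <;>
        simp only [Set.mem_insert_iff, Set.mem_singleton_iff] <;> omega
  · refine Set.Finite.subset Set.finite_empty ?_
    rintro d ⟨h1, h2, rfl | rfl⟩
    · exact hx h1
    · exact hx h2

/-- The topology of the coned-off tree is coherent with the closed cells. -/
theorem isClosed_of_cells {A : Set (ConedTree Γ T)}
    (hA : ∀ (n : ℕ) (i : Cell Γ T n), IsClosed (A ∩ closedCell i)) : IsClosed A := by
  have hq : IsClosed (Quot.mk _ ⁻¹' A : Set (Realization T ⊕ (AxisUnion Γ T × I) ⊕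
      DiscreteCopy (Axis Γ T))) → IsClosed A := (isQuotientMap_quot_mk.isClosed_preimage).1
  apply hq
  rw [isClosed_sum_iff, isClosed_sum_iff]
  refine ⟨?_, ?_, isClosed_discrete _⟩
  · have hq' : IsClosed (Quot.mk (RealizationRel T) ⁻¹' (base ⁻¹' A)) → IsClosed (base ⁻¹' A) :=
      (isQuotientMap_quot_mk.isClosed_preimage).1
    apply hq'
    rw [isClosed_sum_iff]
    refine ⟨isClosed_discrete _, isClosed_of_slices fun d => ?_⟩
    have hpos : ∀ d : T.Dart, IsPositive d → IsClosed {t | base (Realization.edge T d t) ∈ A} := by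
      intro d hd
      have h := (hA 1 (.edge d hd)).preimage
        (continuous_base.comp (Realization.continuous_edge T d))
      convert h using 1
      ext t
      exact (and_iff_left (edge_mem_closedCell d hd t)).symm
    change IsClosed {t | base (Realization.edge T d.val t) ∈ A}
    rcases isPositive_or_symm d.val with hd | hd
    · exact hpos _ hd
    · have h := (hpos _ hd).preimage unitInterval.continuous_symm
      convert h using 1
      ext t
      simp [Realization.edge_symm]
  · let J := {j : Axis Γ T × T.Dart // IsPositive j.2 ∧ j.2.fst ∈ j.1.verts ∧ j.2.snd ∈ j.1.verts}
    -- A closed square contains the cone point, whose preimage is the whole top of the cylinder over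
    -- the line. Cutting down to the part over one line and one edge restores local finiteness.
    let K : J → Set (AxisUnion Γ T × I) := fun j =>
      {q | (⟨q.1.1⟩ : DiscreteCopy (Axis Γ T)) ∈ ({⟨j.1.1⟩} : Set (DiscreteCopy (Axis Γ T)))} ∩
        ({q | q.1.2.1 ∈ edgeLocus T j.1.2} ∩ (fun q => cyl q.1 q.2) ⁻¹'
          (A ∩ closedCell (.square j.1.1 j.1.2 j.2.1 j.2.2.1 j.2.2.2)))
    have hK : ∀ j, IsClosed (K j) := fun j =>
      ((isClosed_discrete _).preimage (continuous_axis.comp continuous_fst)).inter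
        (((isClosed_edgeLocus _).preimage (continuous_point.comp continuous_fst)).inter
          ((hA _ _).preimage continuous_cyl))
    have hfin : LocallyFinite K := by
      rintro ⟨⟨L, p, hp⟩, s⟩
      obtain ⟨x, hx⟩ := Realization.exists_hat_pos T p
      -- On the part over `L` where the coordinate of `x` is positive, only the edges of `L` at `x`
      -- contribute.
      refine ⟨{q | (⟨q.1.1⟩ : DiscreteCopy (Axis Γ T)) ∈ ({⟨L⟩} : Set (DiscreteCopy (Axis Γ T)))} ∩
        {q | 0 < Realization.hat T x q.1.2.1}, IsOpen.mem_nhds ?_ ?_, ?_⟩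
      · exact ((isOpen_discrete _).preimage (continuous_axis.comp continuous_fst)).inter
          (isOpen_lt continuous_const ((Realization.continuous_hat T x).comp
            (continuous_point.comp continuous_fst)))
      · exact ⟨rfl, hx⟩
      · refine ((((Set.finite_singleton L).prod (finite_darts L x))).preimage
          (f := fun j : J => j.1) Subtype.val_injective.injOn).subset ?_
        rintro ⟨⟨L', d⟩, hd, h1, h2⟩ ⟨q, ⟨hq1, hq2, -⟩, hq3, hq4⟩
        have e1 : q.1.1 = L' := congrArg DiscreteCopy.val hq1
        have e2 : q.1.1 = L := congrArg DiscreteCopy.val hq3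
        obtain rfl : L' = L := e1.symm.trans e2
        refine ⟨rfl, h1, h2, ?_⟩
        by_contra! hne
        exact (ne_of_gt hq4) (hq2 x hne.1 hne.2)
    convert hfin.isClosed_iUnion hK using 1
    ext ⟨⟨L, p, hp⟩, s⟩
    rw [Set.mem_iUnion]
    constructor
    · intro h
      obtain ⟨d, t, h1, h2, rfl⟩ := hp
      rcases isPositive_or_symm d with hd | hd
      · exact ⟨⟨(L, d), hd, h1, h2⟩, rfl, edge_mem_edgeLocus d t, h,
          square_mem_closedCell L hd h1 h2 t s⟩
      · have e : Realization.edge T d t = Realization.edge T d.symm (unitInterval.symm t) := by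
          rw [Realization.edge_symm, unitInterval.symm_symm]
        have e1 : Realization.edge T d t ∈ edgeLocus T d.symm := e ▸ edge_mem_edgeLocus d.symm _
        have e2 := square_mem_closedCell L hd h2 h1 (unitInterval.symm t) s
        rw [← onLine_congr L e (L.edge_mem h1 h2 t)] at e2
        exact ⟨⟨(L, d.symm), hd, h2, h1⟩, rfl, e1, h, e2⟩
    · rintro ⟨j, -, -, h, -⟩
      exact h

theorem continuousOn_coords {n : ℕ} (i : Cell Γ T n) :
    ContinuousOn (coords i) (chart i '' Metric.ball 0 1) := by
  cases i with
  | vertex x => exact continuousOn_const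
  | apex L => exact continuousOn_const
  | edge d hd =>
    refine (continuous_pi fun _ => ?_).continuousOn
    exact ((continuous_bary d.snd).const_mul 2).sub continuous_const
  | ray L x hx =>
    refine (continuous_pi fun _ => ?_).continuousOn
    exact ((continuous_height L).const_mul 2).sub continuous_const
  | square L d hd h1 h2 =>
    refine continuousOn_pi.2 fun j => ?_
    fin_cases j
    · refine ContinuousOn.sub (ContinuousOn.const_mul ?_ 2) continuousOn_const
      refine (continuous_bary d.snd).continuousOn.div
        (continuous_const.sub (continuous_height L)).continuousOn ?_
      rintro _ ⟨u, hu, rfl⟩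
      have := par_lt_one (abs_lt_of_mem_ball hu 1)
      simp only [chart, height_cyl, if_true]
      linarith
    · exact (((continuous_height L).const_mul 2).sub continuous_const).continuousOn

/-- The characteristic map of a cell as a partial equivalence. -/
def chartEquiv {n : ℕ} (i : Cell Γ T n) : PartialEquiv (Fin n → ℝ) (ConedTree Γ T) where
  toFun := chart i
  invFun := coords i
  source := Metric.ball 0 1
  target := chart i '' Metric.ball 0 1
  map_source' _ hu := ⟨_, hu, rfl⟩
  map_target' := by
    rintro _ ⟨u, hu, rfl⟩
    rwa [coords_chart i hu]
  left_inv' _ hu := coords_chart i hu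
  right_inv' := by
    rintro _ ⟨u, hu, rfl⟩
    rw [coords_chart i hu]

/-- The coned-off tree is a CW-complex. -/
@[reducible] def cwComplex : Topology.CWComplex (Set.univ : Set (ConedTree Γ T)) where
  cell := Cell Γ T
  map _ := chartEquiv
  source_eq _ _ := rfl
  continuousOn _ i := (continuous_chart i).continuousOn
  continuousOn_symm _ i := continuousOn_coords i
  pairwiseDisjoint' := by
    rintro ⟨n, i⟩ - ⟨m, j⟩ - hne
    refine Set.disjoint_left.2 ?_
    rintro _ ⟨u, hu, rfl⟩ ⟨w, hw, h⟩
    change chart j w = chart i u at h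
    refine hne (cell_ext i j ?_ ?_)
    · rw [← lines_chart i hu, ← lines_chart j hw, h]
    · rw [← verts_chart i hu, ← verts_chart j hw, h]
  mapsTo' n i := by
    classical
    obtain ⟨s, hs⟩ := exists_boundary i
    refine ⟨fun m => s.preimage (Sigma.mk m) sigma_mk_injective.injOn, fun u hu => ?_⟩
    obtain ⟨⟨m, j⟩, hj, hm, h⟩ := hs u hu
    simp only [Set.mem_iUnion]
    exact ⟨m, hm, j, Finset.mem_preimage.2 hj, h⟩
  closed' _ _ h := isClosed_of_cells h
  union' := by
    refine Set.eq_univ_of_forall fun p => ?_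
    obtain ⟨n, i, u, hu, rfl⟩ := exists_chart_eq p
    simp only [Set.mem_iUnion]
    exact ⟨n, i, u, Metric.ball_subset_closedBall hu, rfl⟩

/-- Every point lies in some open cell, on which the supports are constant, and the supports
determine the cell. Questions about the action on open cells thus become questions about sets of
lines and vertices. -/
theorem mem_openCell_iff {n : ℕ} (i : Cell Γ T n) (p : ConedTree Γ T) :
    p ∈ chart i '' Metric.ball 0 1 ↔ lines p = cellLines i ∧ verts p = cellVerts i := by
  constructor
  · rintro ⟨u, hu, rfl⟩
    exact ⟨lines_chart i hu, verts_chart i hu⟩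
  · rintro ⟨h1, h2⟩
    obtain ⟨m, j, u, hu, rfl⟩ := exists_chart_eq p
    rw [lines_chart j hu] at h1
    rw [verts_chart j hu] at h2
    obtain ⟨rfl, h⟩ := Sigma.mk.inj (cell_ext j i h1 h2)
    obtain rfl := eq_of_heq h
    exact ⟨u, hu, rfl⟩

theorem exists_smul_cell (g : Γ) {n : ℕ} (i : Cell Γ T n) : ∃ j : Cell Γ T n,
    cellLines j = g • cellLines i ∧ cellVerts j = g • cellVerts i := by
  have hpair : ∀ x y : V, g • ({x, y} : Set V) = {g • x, g • y} := fun x y => Set.image_pair _ _ _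
  cases i with
  | vertex x => exact ⟨.vertex (g • x), by simp [cellLines, cellVerts]⟩
  | apex L => exact ⟨.apex (g • L), by simp [cellLines, cellVerts]⟩
  | edge d hd =>
    rcases isPositive_or_symm (g • d) with h | h
    · exact ⟨.edge _ h, by simp [cellLines], (hpair _ _).symm⟩
    · exact ⟨.edge _ h, by simp [cellLines], (Set.pair_comm _ _).trans (hpair _ _).symm⟩
  | ray L x hx => exact ⟨.ray (g • L) (g • x) (smul_mem_verts g hx), by simp [cellLines, cellVerts]⟩
  | square L d hd h1 h2 =>
    rcases isPositive_or_symm (g • d) with h | h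
    · exact ⟨.square (g • L) _ h (smul_mem_verts g h1) (smul_mem_verts g h2), by simp [cellLines],
        (hpair _ _).symm⟩
    · exact ⟨.square (g • L) _ h (smul_mem_verts g h2) (smul_mem_verts g h1), by simp [cellLines],
        (Set.pair_comm _ _).trans (hpair _ _).symm⟩

/-- This is where the absence of inversions enters the CW-structure: an edge mapped to itself might
otherwise be flipped, with only its midpoint fixed. -/
theorem fixes_pair (hI : WithoutInversions Γ T) {g : Γ} (d : T.Dart)
    (h : g • ({d.fst, d.snd} : Set V) = {d.fst, d.snd}) : g • d.fst = d.fst ∧ g • d.snd = d.snd := by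
  have e : ({g • d.fst, g • d.snd} : Set V) = {d.fst, d.snd} := by
    rw [← h]
    exact (Set.image_pair _ _ _).symm
  rcases Set.pair_eq_pair_iff.1 e with h | h
  · exact h
  · exact (hI.not_swap d.adj h.1 h.2).elim

theorem fixes_cellVerts (hI : WithoutInversions Γ T) {g : Γ} {n : ℕ} (i : Cell Γ T n)
    (h : g • cellVerts i = cellVerts i) : ∀ x ∈ cellVerts i, g • x = x := by
  have hs : ∀ y : V, g • ({y} : Set V) = {y} → ∀ x ∈ ({y} : Set V), g • x = x := by
    rintro y hy x rfl
    simpa using hy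
  have hp : ∀ d : T.Dart, g • ({d.fst, d.snd} : Set V) = {d.fst, d.snd} →
      ∀ x ∈ ({d.fst, d.snd} : Set V), g • x = x := by
    rintro d hd x (rfl | rfl)
    · exact (fixes_pair hI d hd).1
    · exact (fixes_pair hI d hd).2
  cases i with
  | vertex y => exact hs y h
  | apex L => exact fun x hx => hx.elim
  | edge d hd => exact hp d h
  | ray L y hy => exact hs y h
  | square L d hd h1 h2 => exact hp d h

theorem fixes_cellLines {g : Γ} {n : ℕ} (i : Cell Γ T n)
    (h : g • cellLines i = cellLines i) : ∀ L ∈ cellLines i, g • L = L := by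
  have hs : ∀ L : Axis Γ T, g • ({L} : Set (Axis Γ T)) = {L} →
      ∀ L' ∈ ({L} : Set (Axis Γ T)), g • L' = L' := by
    rintro L hL x rfl
    simpa using hL
  cases i with
  | vertex y => exact fun x hx => hx.elim
  | apex L => exact hs L h
  | edge d hd => exact fun x hx => hx.elim
  | ray L y hy => exact hs L h
  | square L d hd h1 h2 => exact hs L h

/-- An element that fixes a point fixes the vertices in its support. -/
theorem fixes_verts (hI : WithoutInversions Γ T) {g : Γ} {p : ConedTree Γ T}
    (h : g • verts p = verts p) : ∀ x ∈ verts p, g • x = x := by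
  obtain ⟨n, i, u, hu, rfl⟩ := exists_chart_eq p
  rw [verts_chart i hu] at h ⊢
  exact fixes_cellVerts hI i h

theorem fixes_lines {g : Γ} {p : ConedTree Γ T} (h : g • lines p = lines p) :
    ∀ L ∈ lines p, g • L = L := by
  obtain ⟨n, i, u, hu, rfl⟩ := exists_chart_eq p
  rw [lines_chart i hu] at h ⊢
  exact fixes_cellLines i h

/-- An element that preserves the supports fixes each line and vertex in them, so by equivariance of
the coordinates `g • p` and `p` have equal coordinates. -/
theorem smul_eq_of_support (hI : WithoutInversions Γ T) {g : Γ} {p : ConedTree Γ T}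
    (hl : g • lines p = lines p) (hv : g • verts p = verts p) : g • p = p := by
  apply ext_coords
  · intro L
    by_cases hL : L ∈ lines p
    · conv_lhs => rw [← fixes_lines hl L hL]
      exact height_smul g L p
    · have hL' : L ∉ lines (g • p) := by rwa [lines_smul, hl]
      exact (not_not.1 hL').trans (not_not.1 hL).symm
  · intro x
    by_cases hx : x ∈ verts p
    · conv_lhs => rw [← fixes_verts hI hv x hx]
      exact bary_smul g x p
    · have hx' : x ∉ verts (g • p) := by rwa [verts_smul, hv]
      exact (not_not.1 hx').trans (not_not.1 hx).symm

theorem continuous_smul_conedTree (g : Γ) : Continuous fun p : ConedTree Γ T => g • p := by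
  have h1 : Continuous fun a : AxisUnion Γ T => g • a := by
    refine continuous_axisUnion fun L => ?_
    exact (continuous_onLine (g • L)).comp
      (((continuous_smul_realization T g).comp continuous_subtype_val).subtype_mk
        fun p => smul_mem_support g p.2)
  refine continuous_quot_lift _ (continuous_quot_mk.comp ?_)
  exact Continuous.sumMap (continuous_smul_realization T g)
    (Continuous.sumMap (h1.prodMap continuous_id) continuous_of_discreteTopology)

/-- The coned-off tree is a `Γ`-CW-complex. -/
theorem isGCWComplex (hI : WithoutInversions Γ T) : IsGCWComplex Γ (ConedTree Γ T) where
  t2Space := inferInstance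
  continuous_smul := continuous_smul_conedTree
  exists_cells := by
    refine ⟨cwComplex, fun g n i => ?_, fun g n i h p hp => ?_⟩
    · obtain ⟨j, h1, h2⟩ := exists_smul_cell g (i : Cell Γ T n)
      refine ⟨j, Set.ext fun p => ?_⟩
      rw [Set.mem_smul_set_iff_inv_smul_mem]
      refine (mem_openCell_iff (i : Cell Γ T n) _).trans (Iff.trans ?_ (mem_openCell_iff j p).symm)
      rw [lines_smul, verts_smul, inv_smul_eq_iff, inv_smul_eq_iff, h1, h2]
    · have hp' : g • p ∈ chart (i : Cell Γ T n) '' Metric.ball 0 1 := h.subset ⟨p, hp, rfl⟩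
      obtain ⟨h1, h2⟩ := (mem_openCell_iff (i : Cell Γ T n) p).1 hp
      obtain ⟨h1', h2'⟩ := (mem_openCell_iff (i : Cell Γ T n) _).1 hp'
      rw [lines_smul] at h1'
      rw [verts_smul] at h2'
      exact smul_eq_of_support hI (h1'.trans h1.symm) (h2'.trans h2.symm)

end ConedTree

/-! ### Contraction of the tree along geodesics to a vertex -/

section Climb

variable {V : Type*} {T : SimpleGraph V}

open scoped Classical in
/-- The neighbour of `x` that is closer to the root `v`; the root is its own parent. -/
def parent (T : SimpleGraph V) (v x : V) : V :=
  if h : ∃ y, T.Adj y x ∧ T.dist v x = T.dist v y + 1 then h.choose else x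

theorem parent_eq (hT : T.IsTree) {v x y : V} (h : T.Adj y x) (hd : T.dist v x = T.dist v y + 1) :
    parent T v x = y := by
  have hex : ∃ y, T.Adj y x ∧ T.dist v x = T.dist v y + 1 := ⟨y, h, hd⟩
  rw [parent, dif_pos hex]
  exact parent_unique hT hex.choose_spec.1 h hex.choose_spec.2 hd

theorem parent_root (T : SimpleGraph V) (v : V) : parent T v v = v := by
  rw [parent, dif_neg]
  rintro ⟨y, -, h⟩
  simp at h

theorem parent_spec (hT : T.IsTree) {v x : V} (hx : x ≠ v) :
    T.Adj (parent T v x) x ∧ T.dist v x = T.dist v (parent T v x) + 1 := by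
  have hpos := hT.connected.pos_dist_of_ne (u := v) (v := x) (Ne.symm hx)
  obtain ⟨y, hy, hd⟩ := Between.exists hT v x (n := T.dist v x - 1) (Nat.sub_le _ _)
  have h1 : T.dist y x = 1 := by
    unfold Between at hy
    omega
  have h2 : T.Adj y x := T.dist_eq_one_iff_adj.1 h1
  have h3 : T.dist v x = T.dist v y + 1 := by omega
  rw [parent_eq hT h2 h3]
  exact ⟨h2, h3⟩

open scoped Classical in
/-- The point at distance `r ≤ 1` from `x` on the edge towards the root. -/
def climbEdge (T : SimpleGraph V) (v x : V) (r : ℝ) : Realization T :=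
  if h : T.Adj x (parent T v x) then
    Realization.edge T ⟨(x, parent T v x), h⟩ (Set.projIcc 0 1 zero_le_one r)
  else Realization.vertex T x

theorem continuous_climbEdge (v x : V) : Continuous (climbEdge T v x) := by
  unfold climbEdge
  split_ifs
  · exact (Realization.continuous_edge T _).comp continuous_projIcc
  · exact continuous_const

theorem climbEdge_zero (v x : V) : climbEdge T v x 0 = Realization.vertex T x := by
  unfold climbEdge
  split_ifs
  · rw [Set.projIcc_left]
    exact Realization.edge_zero T _
  · rfl

theorem climbEdge_one (hT : T.IsTree) (v x : V) :
    climbEdge T v x 1 = Realization.vertex T (parent T v x) := by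
  by_cases hx : x = v
  · subst hx
    rw [climbEdge, dif_neg (by simp [parent_root]), parent_root]
  · rw [climbEdge, dif_pos (parent_spec hT hx).1.symm, Set.projIcc_right]
    exact Realization.edge_one T _

theorem climbEdge_dart (hT : T.IsTree) {v : V} {d : T.Dart}
    (hd : T.dist v d.fst = T.dist v d.snd + 1) (t : I) :
    climbEdge T v d.fst t = Realization.edge T d t := by
  have h := parent_eq hT d.adj.symm hd
  rw [climbEdge, dif_pos (h ▸ d.adj), Set.projIcc_val]
  congr 1
  exact SimpleGraph.Dart.ext _ _ (Prod.ext rfl h)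

/-- The point at distance `r` from `x` towards the root, with at most `n` edges passed. -/
def climbAux (T : SimpleGraph V) (v : V) : ℕ → V → ℝ → Realization T
  -- In `climb` the counter is the distance to the root, so in a tree this case is reached only at
  -- the root, where the motion stops.
  | 0, x, _ => Realization.vertex T x
  | n + 1, x, r => if r ≤ 1 then climbEdge T v x r else climbAux T v n (parent T v x) (r - 1)

/-- The point at distance `r` from `x` towards the root `v`. -/
def climb (T : SimpleGraph V) (v x : V) (r : ℝ) : Realization T := climbAux T v (T.dist v x) x r

theorem climbAux_zero (v : V) (n : ℕ) (x : V) : climbAux T v n x 0 = Realization.vertex T x := by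
  cases n with
  | zero => rfl
  | succ n => rw [climbAux, if_pos zero_le_one, climbEdge_zero]

theorem continuous_climbAux (hT : T.IsTree) (v : V) (n : ℕ) (x : V) :
    Continuous (climbAux T v n x) := by
  induction n generalizing x with
  | zero => exact continuous_const
  | succ n ih =>
    refine Continuous.if_le (continuous_climbEdge v x)
      ((ih (parent T v x)).comp (continuous_id.sub continuous_const)) continuous_id
      continuous_const ?_
    rintro r rfl
    simp only [sub_self, climbEdge_one hT, climbAux_zero]

theorem continuous_climb (hT : T.IsTree) (v x : V) : Continuous (climb T v x) :=
  continuous_climbAux hT v _ x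

theorem climb_zero (v x : V) : climb T v x 0 = Realization.vertex T x := climbAux_zero v _ x

theorem climb_of_ne (hT : T.IsTree) {v x : V} (hx : x ≠ v) (r : ℝ) :
    climb T v x r = if r ≤ 1 then climbEdge T v x r else climb T v (parent T v x) (r - 1) := by
  rw [climb, (parent_spec hT hx).2]
  rfl

theorem climb_one_add (hT : T.IsTree) {v x : V} (hx : x ≠ v) {r : ℝ} (hr : 0 ≤ r) :
    climb T v x (1 + r) = climb T v (parent T v x) r := by
  rw [climb_of_ne hT hx]
  rcases hr.eq_or_lt with rfl | hr
  · rw [if_pos (by simp), add_zero, climbEdge_one hT, climb_zero]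
  · rw [if_neg (by linarith)]
    congr 1
    ring

theorem climb_dart (hT : T.IsTree) {v : V} {d : T.Dart}
    (hd : T.dist v d.fst = T.dist v d.snd + 1) (t : I) :
    climb T v d.fst t = Realization.edge T d t := by
  rw [climb_of_ne hT, if_pos t.2.2, climbEdge_dart hT hd]
  intro h
  rw [h] at hd
  simp at hd

theorem climb_dart_one_add (hT : T.IsTree) {v : V} {d : T.Dart}
    (hd : T.dist v d.fst = T.dist v d.snd + 1) {r : ℝ} (hr : 0 ≤ r) :
    climb T v d.fst (1 + r) = climb T v d.snd r := by
  rw [climb_one_add hT _ hr, parent_eq hT d.adj.symm hd]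
  intro h
  rw [h] at hd
  simp at hd

/-- Climbing from a vertex of a set that is closed under parents, except at its lowest vertex
`q`, ends in `q`. -/
theorem climb_eq (hT : T.IsTree) {v q : V} {S : Set V}
    (hS : ∀ x ∈ S, x ≠ q → T.dist v q < T.dist v x ∧ parent T v x ∈ S) {x : V} (hx : x ∈ S) :
    climb T v x (T.dist v x - T.dist v q) = Realization.vertex T q := by
  induction hn : T.dist v x generalizing x with
  | zero =>
    by_cases hxq : x = q
    · subst hxq
      rw [hn, sub_self, climb_zero]
    · have := (hS x hx hxq).1
      omega
  | succ n ih =>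
    by_cases hxq : x = q
    · subst hxq
      rw [hn, sub_self, climb_zero]
    · obtain ⟨h1, h2⟩ := hS x hx hxq
      have hxv : x ≠ v := by
        rintro rfl
        simp at hn
      have h3 := (parent_spec hT hxv).2
      have h4 : T.dist v q ≤ n := by omega
      have h4' : (T.dist v q : ℝ) ≤ n := by exact_mod_cast h4
      rw [← ih h2 (by omega), ← climb_one_add hT hxv (by linarith)]
      congr 1
      push_cast
      ring

/-- The motion of a line towards its lowest vertex stays inside the line, which allows it to be
carried out in the cylinder over the line. -/
theorem climb_mem (hT : T.IsTree) {v q : V} {L : Set V} (hL : IsGeodesicLine T L)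
    (hS : ∀ x ∈ L, x ≠ q → T.dist v q < T.dist v x ∧ parent T v x ∈ L) {x : V} (hx : x ∈ L)
    {r : ℝ} (h0 : 0 ≤ r) (hr : r ≤ T.dist v x - T.dist v q) :
    climb T v x r ∈ lineSupport T L := by
  induction hn : T.dist v x generalizing x r with
  | zero =>
    rw [climb, hn]
    exact vertex_mem_lineSupport hL hx
  | succ n ih =>
    by_cases hxq : x = q
    · subst hxq
      obtain rfl : r = 0 := by linarith
      rw [climb_zero]
      exact vertex_mem_lineSupport hL hx
    · obtain ⟨h1, h2⟩ := hS x hx hxq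
      have hxv : x ≠ v := by
        rintro rfl
        simp at hn
      have h3 := parent_spec hT hxv
      rw [climb_of_ne hT hxv]
      split_ifs with hr1
      · rw [climbEdge, dif_pos h3.1.symm]
        exact ⟨_, _, hx, h2, rfl⟩
      · refine ih h2 (by linarith) ?_ (by omega)
        rw [h3.2] at hr
        push_cast at hr
        linarith

/-- The distance from the root, on the realization. -/
def depth (T : SimpleGraph V) (v : V) : Realization T → ℝ :=
  Quot.lift (Sum.elim (fun x => (T.dist v x.val : ℝ))
    (fun q => (1 - (q.2 : ℝ)) * T.dist v q.1.val.fst + q.2 * T.dist v q.1.val.snd)) (by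
    intro a b h
    cases h with
    | symm d t => simp [add_comm]
    | zero d => simp
    | one d => simp)

theorem depth_vertex (v x : V) : depth T v (Realization.vertex T x) = T.dist v x := rfl

theorem depth_edge (v : V) (d : T.Dart) (t : I) : depth T v (Realization.edge T d t) =
    (1 - (t : ℝ)) * T.dist v d.fst + t * T.dist v d.snd := rfl

theorem continuous_depth (v : V) : Continuous (depth T v) := by
  refine continuous_quot_lift _ (Continuous.sumElim continuous_of_discreteTopology ?_)
  refine continuous_prod_of_discrete_left.2 fun d => ?_
  change Continuous fun t : I => (1 - (t : ℝ)) * (T.dist v d.val.fst : ℝ) +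
    (t : ℝ) * (T.dist v d.val.snd : ℝ)
  fun_prop

open scoped Classical in
/-- The function that moves a point of the realization by `r` towards the root `v`. -/
def moveTo (hT : T.IsTree) (v : V) (r : ℝ) : Realization T → Realization T :=
  -- Truncating `r` at zero makes the definition compatible with the gluing for every real `r`, as
  -- `climb_dart_one_add` needs a non-negative length.
  Quot.lift (Sum.elim (fun x => climb T v x.val (max r 0))
    (fun q => if T.dist v q.1.val.fst = T.dist v q.1.val.snd + 1 then
      climb T v q.1.val.fst (q.2 + max r 0)
      else climb T v q.1.val.snd (unitInterval.symm q.2 + max r 0))) (by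
    intro a b h
    have hr : 0 ≤ max r 0 := le_max_right _ _
    cases h with
    | symm d t =>
      have hadj := hT.dist_eq_dist_add_one_of_adj v d.adj
      simp only [Sum.elim_inr]
      change (if T.dist v d.fst = T.dist v d.snd + 1 then _ else _) =
        (if T.dist v d.snd = T.dist v d.fst + 1 then _ else _)
      rcases hadj with hd | hd
      · rw [if_pos hd, if_neg (by omega), unitInterval.symm_symm]
        rfl
      · rw [if_neg (by omega), if_pos hd]
        rfl
    | zero d =>
      have hadj := hT.dist_eq_dist_add_one_of_adj v d.adj
      simp only [Sum.elim_inr, Sum.elim_inl]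
      rcases hadj with hd | hd
      · rw [if_pos hd]
        simp
      · rw [if_neg (by omega)]
        have := climb_dart_one_add hT (d := d.symm) hd hr
        simpa using this
    | one d =>
      have hadj := hT.dist_eq_dist_add_one_of_adj v d.adj
      simp only [Sum.elim_inr, Sum.elim_inl]
      rcases hadj with hd | hd
      · rw [if_pos hd]
        simpa using climb_dart_one_add hT hd hr
      · rw [if_neg (by omega)]
        simp)

theorem moveTo_vertex (hT : T.IsTree) (v x : V) {r : ℝ} (hr : 0 ≤ r) :
    moveTo hT v r (Realization.vertex T x) = climb T v x r := by
  change climb T v x (max r 0) = _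
  rw [max_eq_left hr]

theorem moveTo_edge (hT : T.IsTree) {v : V} {d : T.Dart}
    (hd : T.dist v d.fst = T.dist v d.snd + 1) (t : I) {r : ℝ} (hr : 0 ≤ r) :
    moveTo hT v r (Realization.edge T d t) = climb T v d.fst (t + r) := by
  change (if T.dist v d.fst = T.dist v d.snd + 1 then climb T v d.fst (t + max r 0) else _) = _
  rw [if_pos hd, max_eq_left hr]

theorem continuous_sum_prod {X Y Z W : Type*} [TopologicalSpace X] [TopologicalSpace Y]
    [TopologicalSpace Z] [TopologicalSpace W] {f : (X ⊕ Y) × Z → W}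
    (h1 : Continuous fun q : X × Z => f (Sum.inl q.1, q.2))
    (h2 : Continuous fun q : Y × Z => f (Sum.inr q.1, q.2)) : Continuous f := by
  rw [← Homeomorph.sumProdDistrib.symm.comp_continuous_iff']
  exact continuous_sum_dom.2 ⟨h1, h2⟩

/-- Since `ℝ` is locally compact, the product of the gluing map with `ℝ` is still a quotient map,
and joint continuity can be checked on vertices and single edges. -/
theorem continuous_moveTo (hT : T.IsTree) (v : V) :
    Continuous fun q : Realization T × ℝ => moveTo hT v q.2 q.1 := by
  classical
  refine isQuotientMap_quot_mk.continuous_lift_prod_left (continuous_sum_prod ?_ ?_)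
  · refine continuous_prod_of_discrete_left.2 fun x => ?_
    exact (continuous_climb hT v x.val).comp (continuous_id.max continuous_const)
  · have key : ∀ d : T.Dart, Continuous fun q : I × ℝ => moveTo hT v q.2 (Realization.edge T d q.1) := by
      intro d
      by_cases hd : T.dist v d.fst = T.dist v d.snd + 1
      · have h : Continuous fun q : I × ℝ => climb T v d.fst (q.1 + max q.2 0) :=
          (continuous_climb hT v d.fst).comp ((continuous_subtype_val.comp continuous_fst).add
            (continuous_snd.max continuous_const))
        refine h.congr fun q => ?_
        exact (if_pos hd).symm
      · have h : Continuous fun q : I × ℝ =>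
            climb T v d.snd (unitInterval.symm q.1 + max q.2 0) :=
          (continuous_climb hT v d.snd).comp ((continuous_subtype_val.comp
            (unitInterval.continuous_symm.comp continuous_fst)).add
            (continuous_snd.max continuous_const))
        refine h.congr fun q => ?_
        exact (if_neg hd).symm
    have h2 : Continuous fun q : DiscreteCopy T.Dart × (I × ℝ) =>
        moveTo hT v q.2.2 (Realization.edge T q.1.val q.2.1) :=
      continuous_prod_of_discrete_left.2 fun d => key d.val
    exact h2.comp (Homeomorph.prodAssoc (DiscreteCopy T.Dart) I ℝ).continuous

/-- Every point is reached by climbing at most one edge from a vertex. -/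
theorem exists_climb (hT : T.IsTree) (v : V) {L : Set V} {p : Realization T}
    (hp : p ∈ lineSupport T L) : ∃ x ∈ L, ∃ a : ℝ, 0 ≤ a ∧
      (∃ y ∈ L, T.dist v y + a ≤ (T.dist v x : ℝ)) ∧ depth T v p = T.dist v x - a ∧
      ∀ r, 0 ≤ r → moveTo hT v r p = climb T v x (a + r) := by
  have key : ∀ (d : T.Dart) (t : I), T.dist v d.fst = T.dist v d.snd + 1 →
      d.fst ∈ L → d.snd ∈ L → ∃ x ∈ L, ∃ a : ℝ, 0 ≤ a ∧
      (∃ y ∈ L, T.dist v y + a ≤ (T.dist v x : ℝ)) ∧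
      depth T v (Realization.edge T d t) = T.dist v x - a ∧
      ∀ r, 0 ≤ r → moveTo hT v r (Realization.edge T d t) = climb T v x (a + r) := by
    intro d t hd h1 h2
    refine ⟨d.fst, h1, t, t.2.1, ⟨d.snd, h2, ?_⟩, ?_, fun r hr => moveTo_edge hT hd t hr⟩
    · rw [hd]
      push_cast
      linarith [t.2.2]
    · rw [depth_edge, hd]
      push_cast
      ring
  obtain ⟨d, t, h1, h2, rfl⟩ := hp
  rcases hT.dist_eq_dist_add_one_of_adj v d.adj with hd | hd
  · exact key d t hd h1 h2
  · have := key d.symm (unitInterval.symm t) hd h2 h1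
    rwa [Realization.edge_symm, unitInterval.symm_symm] at this

theorem moveTo_zero (hT : T.IsTree) (v : V) (p : Realization T) : moveTo hT v 0 p = p := by
  induction p using Quot.ind with
  | mk a =>
    rcases a with x | ⟨⟨d⟩, t⟩
    · exact (moveTo_vertex hT v x.val le_rfl).trans (climb_zero v x.val)
    · change moveTo hT v 0 (Realization.edge T d t) = Realization.edge T d t
      rcases hT.dist_eq_dist_add_one_of_adj v d.adj with hd | hd
      · rw [moveTo_edge hT hd t le_rfl, add_zero, climb_dart hT hd]
      · have e : Realization.edge T d t = Realization.edge T d.symm (unitInterval.symm t) := by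
          rw [Realization.edge_symm, unitInterval.symm_symm]
        rw [e, moveTo_edge hT (d := d.symm) hd _ le_rfl, add_zero, climb_dart hT (d := d.symm) hd]

theorem moveTo_depth (hT : T.IsTree) (v : V) (p : Realization T) :
    0 ≤ depth T v p ∧ moveTo hT v (depth T v p) p = Realization.vertex T v := by
  have hS : ∀ x ∈ (Set.univ : Set V), x ≠ v →
      T.dist v v < T.dist v x ∧ parent T v x ∈ (Set.univ : Set V) := fun x _ hx => by
    rw [SimpleGraph.dist_self]
    exact ⟨hT.connected.pos_dist_of_ne (Ne.symm hx), Set.mem_univ _⟩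
  have hc : ∀ x, climb T v x (T.dist v x) = Realization.vertex T v := fun x => by
    have := climb_eq hT hS (Set.mem_univ x)
    simpa using this
  -- Every point lies on a closed edge unless the tree is a single vertex; that degenerate case is
  -- treated directly.
  by_cases hp : p ∈ lineSupport T (Set.univ : Set V)
  · obtain ⟨x, -, a, ha, ⟨y, -, hy⟩, h1, h2⟩ := exists_climb hT v hp
    have h0 : 0 ≤ depth T v p := by
      rw [h1]
      have : (0 : ℝ) ≤ T.dist v y := Nat.cast_nonneg _
      linarith
    refine ⟨h0, ?_⟩
    rw [h2 _ h0, h1, add_sub_cancel, hc]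
  · rcases Realization.exists_eq T p with ⟨x, rfl⟩ | ⟨d, t, -, -, rfl⟩
    · have h0 : (0 : ℝ) ≤ T.dist v x := Nat.cast_nonneg _
      rw [depth_vertex]
      exact ⟨h0, by rw [moveTo_vertex hT v x h0, hc]⟩
    · exact absurd ⟨d, t, Set.mem_univ _, Set.mem_univ _, rfl⟩ hp

/-- Adjacent vertices are never equally far from `v`, so the first step increases the distance, and
without backtracking so does every later one. -/
theorem dist_succ_of_ray (hT : T.IsTree) {v : V} {f : ℕ → V} (hadj : ∀ n, T.Adj (f n) (f (n + 1)))
    (hne : ∀ n, f n ≠ f (n + 2)) (h0 : T.dist v (f 0) ≤ T.dist v (f 1)) (n : ℕ) :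
    T.dist v (f (n + 1)) = T.dist v (f n) + 1 := by
  induction n with
  | zero =>
    rcases hT.dist_eq_dist_add_one_of_adj v (hadj 0) with h | h
    · simp only [zero_add] at h
      omega
    · exact h
  | succ n ih => exact dist_succ_of_ne hT (hadj n) (hadj (n + 1)) (hne n) ih

/-- A geodesic line has a unique lowest vertex, and contains the parents of its other vertices. -/
theorem exists_foot (hT : T.IsTree) (v : V) {L : Set V} (hL : IsGeodesicLine T L) :
    ∃ q ∈ L, ∀ x ∈ L, x ≠ q → T.dist v q < T.dist v x ∧ parent T v x ∈ L := by
  obtain ⟨f, hf, rfl⟩ := hL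
  obtain ⟨i, hi⟩ : ∃ i, ∀ j, T.dist v (f i) ≤ T.dist v (f j) :=
    ⟨Function.argmin fun i => T.dist v (f i), fun j =>
      Function.argmin_le (fun i => T.dist v (f i)) j⟩
  have hinj := geodesic_injective hf
  -- The line is cut at a vertex closest to `v` into two rays. Along each of them the distance to
  -- `v` grows by one in every step, so the parent of a vertex is its predecessor on the ray.
  have key : ∀ g : ℕ → V, g 0 = f i → (∀ n, g n ∈ Set.range f) → (∀ n, T.Adj (g n) (g (n + 1))) →
      (∀ n, g n ≠ g (n + 2)) → ∀ n, g n ≠ f i →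
        T.dist v (f i) < T.dist v (g n) ∧ parent T v (g n) ∈ Set.range f := by
    intro g h0 hmem hadj hne n hn
    have h := dist_succ_of_ray hT hadj hne (by
      rw [h0]
      obtain ⟨j, hj⟩ := hmem 1
      rw [← hj]
      exact hi j)
    have hle : ∀ n, T.dist v (g n) = T.dist v (f i) + n := by
      intro n
      induction n with
      | zero => rw [h0, add_zero]
      | succ n ih =>
        rw [h, ih, add_assoc]
    cases n with
    | zero => exact absurd h0 hn
    | succ n =>
      rw [parent_eq hT (hadj n) (h n), hle]
      exact ⟨by omega, hmem n⟩
  refine ⟨f i, ⟨i, rfl⟩, ?_⟩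
  rintro _ ⟨j, rfl⟩ hne
  rcases le_total i j with h | h
  · obtain ⟨n, rfl⟩ := Int.le.dest h
    refine key (fun n => f (i + n)) (by simp) (fun n => ⟨_, rfl⟩) (fun n => ?_) (fun n h => ?_) n hne
    · have := adj_of_geodesic hf (i + n)
      rwa [add_assoc] at this
    · have := hinj h
      push_cast at this
      omega
  · obtain ⟨n, hn⟩ := Int.le.dest h
    obtain rfl : j = i - n := by omega
    refine key (fun n => f (i - n)) (by simp) (fun n => ⟨_, rfl⟩) (fun n => ?_) (fun n h => ?_) n hne
    · have := (adj_of_geodesic hf (i - (n + 1 : ℕ))).symm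
      push_cast at this ⊢
      rw [sub_add_eq_sub_sub, sub_add_cancel] at this
      rwa [sub_add_eq_sub_sub]
    · have := hinj h
      push_cast at this
      omega

end Climb

/-! ### Equivariance under elements that fix the root -/

section ClimbAction

variable {Γ V : Type*} [Group Γ] [MulAction Γ V] {T : SimpleGraph V} [GraphAction Γ T]

theorem dist_smul_of_fixed {g : Γ} {v : V} (hg : g • v = v) (x : V) :
    T.dist v (g • x) = T.dist v x := by
  conv_lhs => rw [← hg]
  exact dist_smul T g v x

theorem parent_smul (hT : T.IsTree) {g : Γ} {v : V} (hg : g • v = v) (x : V) :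
    parent T v (g • x) = g • parent T v x := by
  by_cases hx : x = v
  · rw [hx, hg, parent_root, hg]
  · obtain ⟨h1, h2⟩ := parent_spec hT hx
    refine parent_eq hT ((smul_adj_iff g).2 h1) ?_
    rw [dist_smul_of_fixed hg, dist_smul_of_fixed hg, h2]

theorem climbEdge_smul (hT : T.IsTree) {g : Γ} {v : V} (hg : g • v = v) (x : V) (r : ℝ) :
    climbEdge T v (g • x) r = g • climbEdge T v x r := by
  have hp := parent_smul hT hg x
  by_cases h : T.Adj x (parent T v x)
  · have h' : T.Adj (g • x) (parent T v (g • x)) := by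
      rw [hp]
      exact (smul_adj_iff g).2 h
    rw [climbEdge, climbEdge, dif_pos h, dif_pos h', Realization.smul_edge]
    congr 1
    exact SimpleGraph.Dart.ext _ _ (Prod.ext rfl hp)
  · have h' : ¬ T.Adj (g • x) (parent T v (g • x)) := by
      rw [hp]
      exact fun h'' => h ((smul_adj_iff g).1 h'')
    rw [climbEdge, climbEdge, dif_neg h, dif_neg h', Realization.smul_vertex]

theorem climb_smul (hT : T.IsTree) {g : Γ} {v : V} (hg : g • v = v) (x : V) (r : ℝ) :
    climb T v (g • x) r = g • climb T v x r := by
  have key : ∀ n x r, climbAux T v n (g • x) r = g • climbAux T v n x r := by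
    intro n
    induction n with
    | zero => exact fun x r => rfl
    | succ n ih =>
      intro x r
      rw [climbAux, climbAux]
      split_ifs
      · exact climbEdge_smul hT hg x r
      · rw [parent_smul hT hg, ih]
  rw [climb, dist_smul_of_fixed hg, key, climb]

theorem depth_smul {g : Γ} {v : V} (hg : g • v = v) (p : Realization T) :
    depth T v (g • p) = depth T v p := by
  induction p using Quot.ind with
  | mk a =>
    rcases a with x | ⟨⟨d⟩, t⟩
    · exact congrArg Nat.cast (dist_smul_of_fixed hg x.val)
    · change depth T v (Realization.edge T (g • d) t) = depth T v (Realization.edge T d t)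
      rw [depth_edge, depth_edge]
      change (1 - (t : ℝ)) * T.dist v (g • d.fst) + t * T.dist v (g • d.snd) = _
      rw [dist_smul_of_fixed hg, dist_smul_of_fixed hg]

theorem moveTo_smul (hT : T.IsTree) {g : Γ} {v : V} (hg : g • v = v) {r : ℝ} (hr : 0 ≤ r)
    (p : Realization T) : moveTo hT v r (g • p) = g • moveTo hT v r p := by
  have key : ∀ (d : T.Dart) (t : I), T.dist v d.fst = T.dist v d.snd + 1 →
      moveTo hT v r (g • Realization.edge T d t) = g • moveTo hT v r (Realization.edge T d t) := by
    intro d t hd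
    rw [Realization.smul_edge, moveTo_edge hT hd t hr, moveTo_edge hT _ t hr]
    · exact climb_smul hT hg _ _
    · change T.dist v (g • d.fst) = T.dist v (g • d.snd) + 1
      rw [dist_smul_of_fixed hg, dist_smul_of_fixed hg, hd]
  induction p using Quot.ind with
  | mk a =>
    rcases a with x | ⟨⟨d⟩, t⟩
    · change moveTo hT v r (Realization.vertex T (g • x.val)) =
        g • moveTo hT v r (Realization.vertex T x.val)
      rw [moveTo_vertex hT v _ hr, moveTo_vertex hT v _ hr, climb_smul hT hg]
    · rcases hT.dist_eq_dist_add_one_of_adj v d.adj with hd | hd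
      · exact key d t hd
      · have := key d.symm (unitInterval.symm t) hd
        rwa [Realization.edge_symm, unitInterval.symm_symm] at this

end ClimbAction

/-- Equivariant homotopies restrict to fixed point sets. Two stages are allowed, so that the
deformation into the tree and the contraction of the tree can be supplied separately. -/
theorem contractibleSpace_fixedPoints {Γ X : Type*} [Group Γ] [TopologicalSpace X] [MulAction Γ X]
    (H : Subgroup Γ) {D E : I → X → X} (hD : Continuous fun q : X × I => D q.2 q.1)
    (hE : Continuous fun q : X × I => E q.2 q.1) (hDH : ∀ h ∈ H, ∀ s x, D s (h • x) = h • D s x)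
    (hEH : ∀ h ∈ H, ∀ s x, E s (h • x) = h • E s x) (hD0 : ∀ x, D 0 x = x)
    (hDE : ∀ x, D 1 x = E 0 x) {x₀ : X} (hE1 : ∀ x, E 1 x = x₀) (hx₀ : ∀ h ∈ H, h • x₀ = x₀) :
    ContractibleSpace (MulAction.fixedPoints H X) := by
  have hmem : ∀ F : I → X → X, (∀ h ∈ H, ∀ s x, F s (h • x) = h • F s x) → ∀ s,
      ∀ x : MulAction.fixedPoints H X, F s x ∈ MulAction.fixedPoints H X := by
    rintro F hF s ⟨x, hx⟩ ⟨h, hh⟩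
    change h • F s x = F s x
    rw [← hF h hh]
    congr 1
    exact hx ⟨h, hh⟩
  have hcont : ∀ F : I → X → X, (Continuous fun q : X × I => F q.2 q.1) →
      ∀ hF : ∀ h ∈ H, ∀ s x, F s (h • x) = h • F s x,
      Continuous fun q : I × MulAction.fixedPoints H X =>
        (⟨F q.1 q.2, hmem F hF q.1 q.2⟩ : MulAction.fixedPoints H X) := fun F hc hF =>
    (hc.comp ((continuous_subtype_val.comp continuous_snd).prodMk continuous_fst)).subtype_mk _
  rw [contractible_iff_id_nullhomotopic]
  refine ⟨⟨x₀, fun h => hx₀ h h.2⟩, ?_⟩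
  let f₁ : C(MulAction.fixedPoints H X, MulAction.fixedPoints H X) :=
    ⟨fun x => ⟨D 1 x, hmem D hDH 1 x⟩, (hcont D hD hDH).comp
      (continuous_const.prodMk continuous_id)⟩
  have h1 : ContinuousMap.Homotopic (ContinuousMap.id _) f₁ :=
    ⟨{ toFun := _
       continuous_toFun := hcont D hD hDH
       map_zero_left := fun x => Subtype.ext (hD0 x)
       map_one_left := fun x => rfl }⟩
  refine h1.trans ⟨{ toFun := _
                     continuous_toFun := hcont E hE hEH
                     map_zero_left := fun x => Subtype.ext (hDE x).symm
                     map_one_left := fun x => Subtype.ext (hE1 x) }⟩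

/-! ### Equivariant contraction of the coned-off tree to a fixed vertex -/

namespace ConedTree

variable {Γ : Type*} {V : Type*} [Group Γ] [MulAction Γ V] {T : SimpleGraph V} [GraphAction Γ T]

/-- The vertex of a line that is closest to the root. -/
def foot (hT : T.IsTree) (v : V) (L : Axis Γ T) : V := (exists_foot hT v L.isGeodesicLine).choose

theorem foot_mem (hT : T.IsTree) (v : V) (L : Axis Γ T) : foot hT v L ∈ L.verts :=
  (exists_foot hT v L.isGeodesicLine).choose_spec.1

theorem foot_spec (hT : T.IsTree) (v : V) (L : Axis Γ T) : ∀ x ∈ L.verts, x ≠ foot hT v L →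
    T.dist v (foot hT v L) < T.dist v x ∧ parent T v x ∈ L.verts :=
  (exists_foot hT v L.isGeodesicLine).choose_spec.2

theorem dist_foot_le (hT : T.IsTree) (v : V) (L : Axis Γ T) {x : V} (hx : x ∈ L.verts) :
    T.dist v (foot hT v L) ≤ T.dist v x := by
  by_cases h : x = foot hT v L
  · rw [h]
  · exact (foot_spec hT v L x hx h).1.le

/-- The foot is the only vertex of the line at minimal distance from `v`, and `g` preserves
distances from `v`. -/
theorem foot_smul (hT : T.IsTree) {v : V} {g : Γ} (hg : g • v = v) (L : Axis Γ T) :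
    foot hT v (g • L) = g • foot hT v L := by
  by_contra hne
  have h1 := (foot_spec hT v (g • L) _ (smul_mem_verts g (foot_mem hT v L)) (Ne.symm hne)).1
  have h2 := smul_mem_verts g⁻¹ (foot_mem hT v (g • L))
  rw [inv_smul_smul] at h2
  have h3 := dist_foot_le hT v L h2
  rw [dist_smul_of_fixed (inv_smul_eq_iff.2 hg.symm)] at h3
  rw [dist_smul_of_fixed hg] at h1
  omega

/-- The distance of a point of a line to the foot of the line. -/
def rise (hT : T.IsTree) (v : V) (L : Axis Γ T) (p : Realization T) : ℝ :=
  depth T v p - T.dist v (foot hT v L)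

theorem continuous_rise (hT : T.IsTree) (v : V) (L : Axis Γ T) : Continuous (rise hT v L) :=
  (continuous_depth v).sub continuous_const

/-- A point of the line lies on an edge with both ends in the line, and it is at least as deep as
the lower end, hence as the foot. -/
theorem rise_nonneg (hT : T.IsTree) (v : V) {L : Axis Γ T} {p : Realization T}
    (hp : p ∈ L.support) : 0 ≤ rise hT v L p := by
  obtain ⟨x, -, a, -, ⟨y, hy, hya⟩, h, -⟩ := exists_climb hT v hp
  have h2 : (T.dist v (foot hT v L) : ℝ) ≤ T.dist v y := by exact_mod_cast dist_foot_le hT v L hy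
  rw [rise, h]
  linarith

theorem rise_smul (hT : T.IsTree) {v : V} {g : Γ} (hg : g • v = v) (L : Axis Γ T)
    (p : Realization T) : rise hT v (g • L) (g • p) = rise hT v L p := by
  rw [rise, rise, depth_smul hg, foot_smul hT hg, dist_smul_of_fixed hg]

/-- Contraction of a line to its foot. -/
def slide (hT : T.IsTree) (v : V) (L : Axis Γ T) (s : ℝ) (p : Realization T) : Realization T :=
  moveTo hT v (s * rise hT v L p) p

theorem slide_mem (hT : T.IsTree) (v : V) {L : Axis Γ T} (s : I) {p : Realization T}
    (hp : p ∈ L.support) : slide hT v L s p ∈ L.support := by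
  have h0 := rise_nonneg hT v hp
  obtain ⟨x, hx, a, ha, -, h, hm⟩ := exists_climb hT v hp
  rw [slide, hm _ (mul_nonneg s.2.1 h0)]
  refine climb_mem hT L.isGeodesicLine (foot_spec hT v L) hx
    (add_nonneg ha (mul_nonneg s.2.1 h0)) ?_
  have := mul_le_of_le_one_left h0 s.2.2
  rw [rise, h] at this ⊢
  linarith

theorem slide_zero (hT : T.IsTree) (v : V) (L : Axis Γ T) (p : Realization T) :
    slide hT v L 0 p = p := by
  rw [slide, zero_mul, moveTo_zero]

/-- The distance moved is proportional to the distance from the foot, so all points of the line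
arrive at time `1`. -/
theorem slide_one (hT : T.IsTree) (v : V) {L : Axis Γ T} {p : Realization T}
    (hp : p ∈ L.support) : slide hT v L 1 p = Realization.vertex T (foot hT v L) := by
  have h0 := rise_nonneg hT v hp
  obtain ⟨x, hx, a, ha, -, h, hm⟩ := exists_climb hT v hp
  rw [slide, one_mul, hm _ h0, ← climb_eq hT (foot_spec hT v L) hx]
  congr 1
  rw [rise, h]
  ring

theorem slide_smul (hT : T.IsTree) {v : V} {g : Γ} (hg : g • v = v) {L : Axis Γ T} (s : I)
    {p : Realization T} (hp : p ∈ L.support) :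
    slide hT v (g • L) s (g • p) = g • slide hT v L s p := by
  rw [slide, rise_smul hT hg, moveTo_smul hT hg (mul_nonneg s.2.1 (rise_nonneg hT v hp)), slide]

theorem continuous_slide (hT : T.IsTree) (v : V) (L : Axis Γ T) :
    Continuous fun q : Realization T × ℝ => slide hT v L q.2 q.1 :=
  (continuous_moveTo hT v).comp (continuous_fst.prodMk
    (continuous_snd.mul ((continuous_rise hT v L).comp continuous_fst)))

theorem continuous_axisUnion_prod {Y Z : Type*} [TopologicalSpace Y] [TopologicalSpace Z]
    {f : AxisUnion Γ T × Y → Z}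
    (h : ∀ L : Axis Γ T, Continuous fun q : L.support × Y => f (onLine L q.1.1 q.1.2, q.2)) :
    Continuous f := by
  let e := Homeomorph.sigmaProdDistrib (Y := Y) (X := fun L : Axis Γ T => lineSupport T L.1)
  exact e.symm.comp_continuous_iff'.1 (continuous_sigma h)

/-- The line coordinate of the deformation of the cones into the tree. -/
def slideParam (s : I) : I := Set.projIcc 0 1 zero_le_one (2 * s)

/-- The cone coordinate of the deformation of the cones into the tree. -/
def dropParam (s : I) : I := Set.projIcc 0 1 zero_le_one (2 - 2 * s)

theorem continuous_slideParam : Continuous slideParam :=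
  continuous_projIcc.comp (continuous_const.mul continuous_subtype_val)

theorem continuous_dropParam : Continuous dropParam :=
  continuous_projIcc.comp (continuous_const.sub (continuous_const.mul continuous_subtype_val))

theorem slideParam_zero : slideParam 0 = 0 := by simp [slideParam]

theorem dropParam_zero : dropParam 0 = 1 :=
  Set.projIcc_of_right_le _ (by norm_num)

theorem slideParam_one : slideParam 1 = 1 :=
  Set.projIcc_of_right_le _ (by norm_num)

theorem dropParam_one : dropParam 1 = 0 := by simp [dropParam]

/-- The line slides to its foot during the first half, while the cone coordinate is lowered only in
the second half. So the top of the cylinder is always mapped to a single point: to the cone point in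
the first half, to the ray over the foot in the second. This makes `deform` compatible with the
collapse. -/
theorem slideParam_or_dropParam (s : I) : slideParam s = 1 ∨ dropParam s = 1 := by
  rcases le_total (1 / 2) (s : ℝ) with h | h
  · exact Or.inl (Set.projIcc_of_right_le _ (by linarith))
  · exact Or.inr (Set.projIcc_of_right_le _ (by linarith))

theorem cyl_congr {L : Axis Γ T} {p q : Realization T} (h : p = q) (hp : p ∈ L.support)
    (hq : q ∈ L.support) (t : I) : cyl (onLine L p hp) t = cyl (onLine L q hq) t := by
  rw [onLine_congr L h hp hq]

/-- The deformation of the coned-off tree into the tree. -/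
def deform (hT : T.IsTree) (v : V) (s : I) : ConedTree Γ T → ConedTree Γ T :=
  Quot.lift (Sum.elim base (Sum.elim
    (fun q => cyl (onLine q.1.1 (slide hT v q.1.1 (slideParam s * q.2 : I) q.1.2.1)
      (slide_mem hT v _ q.1.2.2)) (dropParam s * q.2))
    (fun z => cyl (onLine z.val (Realization.vertex T (foot hT v z.val))
      (z.val.vertex_mem (foot_mem hT v z.val))) (dropParam s)))) (by
    intro a b h
    cases h with
    | zero a =>
      obtain ⟨L, p, hp⟩ := a
      replace hp : p ∈ L.support := hp
      change cyl (onLine L (slide hT v L (slideParam s * 0 : I) p) (slide_mem hT v _ hp))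
        (dropParam s * 0) = base p
      rw [mul_zero (dropParam s), cyl_zero, mul_zero, Set.Icc.coe_zero, slide_zero]
    | one a =>
      obtain ⟨L, p, hp⟩ := a
      replace hp : p ∈ L.support := hp
      change cyl (onLine L (slide hT v L (slideParam s * 1 : I) p) (slide_mem hT v _ hp))
        (dropParam s * 1) = cyl (onLine L (Realization.vertex T (foot hT v L))
          (L.vertex_mem (foot_mem hT v L))) (dropParam s)
      rw [mul_one (dropParam s)]
      rcases slideParam_or_dropParam s with h | h
      · refine cyl_congr ?_ _ _ _
        rw [h, mul_one, Set.Icc.coe_one, slide_one hT v hp]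
      · rw [h, cyl_one, cyl_one])

theorem deform_cyl (hT : T.IsTree) (v : V) (s : I) (L : Axis Γ T) {p : Realization T}
    (hp : p ∈ L.support) (t : I) : deform hT v s (cyl (onLine L p hp) t) =
      cyl (onLine L (slide hT v L (slideParam s * t : I) p) (slide_mem hT v _ hp))
        (dropParam s * t) := rfl

theorem deform_apex (hT : T.IsTree) (v : V) (s : I) (L : Axis Γ T) : deform hT v s (apex L) =
    cyl (onLine L (Realization.vertex T (foot hT v L)) (L.vertex_mem (foot_mem hT v L)))
      (dropParam s) := rfl

theorem continuous_deform (hT : T.IsTree) (v : V) :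
    Continuous fun q : ConedTree Γ T × I => deform hT v q.2 q.1 := by
  refine isQuotientMap_quot_mk.continuous_lift_prod_left (continuous_sum_prod ?_
    (continuous_sum_prod ?_ ?_))
  · exact continuous_base.comp continuous_fst
  · have h : Continuous fun q : AxisUnion Γ T × (I × I) =>
        deform hT v q.2.2 (cyl q.1 q.2.1) := by
      refine continuous_axisUnion_prod fun L => ?_
      have hs : Continuous fun q : L.support × (I × I) =>
          slide hT v L (slideParam q.2.2 * q.2.1 : I) q.1 :=
        (continuous_slide hT v L).comp ((continuous_subtype_val.comp continuous_fst).prodMk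
          (continuous_subtype_val.comp ((continuous_slideParam.comp
            (continuous_snd.comp continuous_snd)).mul (continuous_fst.comp continuous_snd))))
      have hs' := (continuous_onLine L).comp
        (hs.subtype_mk fun q => slide_mem hT v _ q.1.2)
      exact continuous_cyl.comp (hs'.prodMk ((continuous_dropParam.comp
        (continuous_snd.comp continuous_snd)).mul (continuous_fst.comp continuous_snd)))
    exact h.comp (Homeomorph.prodAssoc (AxisUnion Γ T) I I).continuous
  · refine continuous_prod_of_discrete_left.2 fun L => ?_
    exact continuous_cyl.comp ((continuous_const (y := onLine L.val
      (Realization.vertex T (foot hT v L.val)) (L.val.vertex_mem (foot_mem hT v L.val)))).prodMk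
        continuous_dropParam)

theorem deform_zero (hT : T.IsTree) (v : V) (p : ConedTree Γ T) : deform hT v 0 p = p := by
  induction p using ind with
  | h1 p => rfl
  | h2 L p hp t =>
    rw [deform_cyl, dropParam_zero, one_mul]
    congr 1
    refine onLine_congr L ?_ _ _
    rw [slideParam_zero, zero_mul, Set.Icc.coe_zero, slide_zero]
  | h3 L => rw [deform_apex, dropParam_zero, cyl_one]

theorem deform_smul (hT : T.IsTree) {v : V} {g : Γ} (hg : g • v = v) (s : I)
    (p : ConedTree Γ T) : deform hT v s (g • p) = g • deform hT v s p := by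
  induction p using ind with
  | h1 p => rfl
  | h2 L p hp t =>
    rw [smul_cyl, deform_cyl, deform_cyl, smul_cyl]
    exact cyl_congr (slide_smul hT hg _ hp) _ _ _
  | h3 L =>
    rw [smul_apex, deform_apex, deform_apex, smul_cyl]
    refine cyl_congr ?_ _ _ _
    rw [foot_smul hT hg, Realization.smul_vertex]

/-- The retraction of the coned-off tree to the tree. -/
def retract (hT : T.IsTree) (v : V) : ConedTree Γ T → Realization T :=
  Quot.lift (Sum.elim id (Sum.elim (fun q => slide hT v q.1.1 q.2 q.1.2.1)
    (fun z => Realization.vertex T (foot hT v z.val)))) (by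
    intro a b h
    cases h with
    | zero a => exact slide_zero hT v a.1 a.2.1
    | one a => exact slide_one hT v a.2.2)

theorem retract_cyl (hT : T.IsTree) (v : V) (L : Axis Γ T) {p : Realization T}
    (hp : p ∈ L.support) (t : I) : retract hT v (cyl (onLine L p hp) t) = slide hT v L t p := rfl

theorem retract_apex (hT : T.IsTree) (v : V) (L : Axis Γ T) :
    retract hT v (apex L) = Realization.vertex T (foot hT v L) := rfl

theorem continuous_retract (hT : T.IsTree) (v : V) :
    Continuous (retract hT v : ConedTree Γ T → Realization T) := by
  refine continuous_quot_lift _ (Continuous.sumElim continuous_id (Continuous.sumElim ?_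
    continuous_of_discreteTopology))
  refine continuous_axisUnion_prod fun L => ?_
  exact (continuous_slide hT v L).comp ((continuous_subtype_val.comp continuous_fst).prodMk
    (continuous_subtype_val.comp continuous_snd))

theorem deform_one (hT : T.IsTree) (v : V) (p : ConedTree Γ T) :
    deform hT v 1 p = base (retract hT v p) := by
  induction p using ind with
  | h1 p => rfl
  | h2 L p hp t =>
    rw [deform_cyl, dropParam_one, zero_mul, slideParam_one, one_mul, cyl_zero, retract_cyl]
  | h3 L => rw [deform_apex, dropParam_one, cyl_zero, retract_apex]

theorem retract_smul (hT : T.IsTree) {v : V} {g : Γ} (hg : g • v = v) (p : ConedTree Γ T) :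
    retract hT v (g • p) = g • retract hT v p := by
  induction p using ind with
  | h1 p => rfl
  | h2 L p hp t => rw [smul_cyl, retract_cyl, retract_cyl, slide_smul hT hg _ hp]
  | h3 L => rw [smul_apex, retract_apex, retract_apex, foot_smul hT hg, Realization.smul_vertex]

/-- If a subgroup fixes a vertex of the tree, then its fixed point set is contractible. -/
theorem contractibleSpace_of_fixes_vertex (hT : T.IsTree) {H : Subgroup Γ} {v : V}
    (hv : ∀ h ∈ H, h • v = v) : ContractibleSpace (MulAction.fixedPoints H (ConedTree Γ T)) := by
  have hr := continuous_retract (Γ := Γ) hT v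
  refine contractibleSpace_fixedPoints H (D := deform hT v)
    (E := fun s p => base (moveTo hT v (s * depth T v (retract hT v p)) (retract hT v p)))
    (x₀ := base (Realization.vertex T v)) (continuous_deform hT v) ?_
    (fun h hh s p => deform_smul hT (hv h hh) s p) ?_ (deform_zero hT v) ?_ ?_ ?_
  · exact continuous_base.comp ((continuous_moveTo hT v).comp ((hr.comp continuous_fst).prodMk
      ((continuous_subtype_val.comp continuous_snd).mul
        ((continuous_depth v).comp (hr.comp continuous_fst)))))
  · intro h hh s p
    rw [retract_smul hT (hv h hh), depth_smul (hv h hh), moveTo_smul hT (hv h hh)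
      (mul_nonneg s.2.1 (moveTo_depth hT v _).1), smul_base]
  · intro p
    rw [deform_one, Set.Icc.coe_zero, zero_mul, moveTo_zero]
  · intro p
    rw [Set.Icc.coe_one, one_mul, (moveTo_depth hT v _).2]
  · intro h hh
    rw [smul_base, Realization.smul_vertex, hv h hh]

/-! ### Fixed point sets of subgroups of isotropy groups -/

/-- A point without vertices in its support is a cone point. -/
theorem exists_eq_apex {p : ConedTree Γ T} (hp : verts p = ∅) : ∃ L, p = apex L := by
  obtain ⟨n, i, u, hu, rfl⟩ := exists_chart_eq p
  rw [verts_chart i hu] at hp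
  cases i with
  | apex L => exact ⟨L, rfl⟩
  | vertex x => exact absurd hp (Set.singleton_ne_empty x)
  | edge d hd => exact absurd hp (Set.insert_nonempty _ _).ne_empty
  | ray L x hx => exact absurd hp (Set.singleton_ne_empty x)
  | square L d hd h1 h2 => exact absurd hp (Set.insert_nonempty _ _).ne_empty

theorem apex_injective : Function.Injective (apex : Axis Γ T → ConedTree Γ T) := by
  intro L L' h
  by_contra hne
  have := congrArg (height L) h
  rw [height_apex, height_apex, if_pos rfl, if_neg (Ne.symm hne)] at this
  exact one_ne_zero this

/-- The fixed point set of a subgroup of an isotropy group is contractible. -/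
theorem contractibleSpace_of_fixes_point (hT : T.IsTree) (hI : WithoutInversions Γ T)
    {H : Subgroup Γ} {p : ConedTree Γ T} (hp : H ≤ MulAction.stabilizer Γ p) :
    ContractibleSpace (MulAction.fixedPoints H (ConedTree Γ T)) := by
  by_cases hv : ∃ v : V, ∀ h ∈ H, h • v = v
  · obtain ⟨v, hv⟩ := hv
    exact contractibleSpace_of_fixes_vertex hT hv
  · push Not at hv
    -- A vertex in the support of a point fixed by `H` would itself be fixed by `H`, so the support
    -- contains no vertices.
    have hapex : ∀ q : ConedTree Γ T, (∀ h ∈ H, h • q = q) →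
        ∃ L : Axis Γ T, q = apex L ∧ ∀ h ∈ H, h • L = L := by
      intro q hq
      obtain ⟨L, rfl⟩ := exists_eq_apex (p := q) (by
        by_contra hne
        obtain ⟨x, hx⟩ := Set.nonempty_iff_ne_empty.2 hne
        obtain ⟨h, hh, hhx⟩ := hv x
        refine hhx (fixes_verts hI (p := q) ?_ x hx)
        rw [← verts_smul, hq h hh])
      exact ⟨L, rfl, fun h hh => apex_injective (hq h hh)⟩
    obtain ⟨L, rfl, hL⟩ := hapex p fun h hh => hp hh
    obtain ⟨g, hg, hfix⟩ := exists_no_fixed_vertex hT hI L.isGeodesicLine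
      (fun h hh => congrArg Subtype.val (hL h hh)) hv
    -- Any other fixed cone point would belong to a second line preserved by `g`, which has no fixed
    -- vertices.
    have hsub : ∀ q : MulAction.fixedPoints H (ConedTree Γ T), (q : ConedTree Γ T) = apex L := by
      rintro ⟨q, hq⟩
      obtain ⟨L', rfl, hL'⟩ := hapex q fun h hh => hq ⟨h, hh⟩
      have : L' = L := Subtype.ext (geodesicLine_unique hT hI L'.isGeodesicLine L.isGeodesicLine
        hfix (congrArg Subtype.val (hL' g hg)) (congrArg Subtype.val (hL g hg)))
      exact congrArg apex this
    have : Unique (MulAction.fixedPoints H (ConedTree Γ T)) :=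
      { default := ⟨apex L, fun h => hp h.2⟩
        uniq := fun q => Subtype.ext (hsub q) }
    infer_instance

end ConedTree

/-! ### The family generated by the isotropy groups -/

section Families

variable {Γ X : Type*} [Group Γ] [MulAction Γ X]

theorem stabilizer_mem_isotropyFamily (x : X) : MulAction.stabilizer Γ x ∈ isotropyFamily Γ X :=
  fun _ _ hS => hS ⟨x, rfl⟩

/-- The explicit form of the generated family; closure under conjugation holds because a conjugate
of a stabilizer is the stabilizer of a translated point. -/
theorem isFamily_subgroups_of_stabilizers [Nonempty X] :
    IsFamily {K : Subgroup Γ | ∃ x : X, K ≤ MulAction.stabilizer Γ x} where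
  nonempty := ⟨⊥, Classical.arbitrary X, bot_le⟩
  conj_mem := by
    rintro H ⟨x, hx⟩ g
    refine ⟨g • x, ?_⟩
    rw [MulAction.stabilizer_smul_eq_stabilizer_map_conj]
    exact Subgroup.map_mono hx
  mem_of_le := fun _ ⟨x, hx⟩ _ hK => ⟨x, hK.trans hx⟩

/-- The isotropy family consists of the subgroups of the isotropy groups. -/
theorem mem_isotropyFamily_iff [Nonempty X] {K : Subgroup Γ} :
    K ∈ isotropyFamily Γ X ↔ ∃ x : X, K ≤ MulAction.stabilizer Γ x := by
  constructor
  · intro h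
    refine h _ isFamily_subgroups_of_stabilizers ?_
    rintro _ ⟨x, rfl⟩
    exact ⟨x, le_rfl⟩
  · rintro ⟨x, hx⟩ F hF hS
    exact hF.mem_of_le _ (hS ⟨x, rfl⟩) K hx

theorem isFamily_isotropyFamily [Nonempty X] : IsFamily (isotropyFamily Γ X) := by
  have : isotropyFamily Γ X = {K : Subgroup Γ | ∃ x : X, K ≤ MulAction.stabilizer Γ x} :=
    Set.ext fun _ => mem_isotropyFamily_iff
  rw [this]
  exact isFamily_subgroups_of_stabilizers

end Families

end
end BassSerre

theorem theorem6p3 {Y : BassSerre.SerreGraph} (G : BassSerre.GraphOfGroups Y)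
    {Γ : Type*} [Group Γ] [Group.FG Γ] {V : Type*} [MulAction Γ V] (T : SimpleGraph V)
    [BassSerre.GraphAction Γ T] (S : G.Splitting Γ T) :
    BassSerre.IsModelFor (BassSerre.isotropyFamily Γ (BassSerre.ConedTree Γ T))
        (BassSerre.ConedTree Γ T) ∧
      (BassSerre.IsAcylindrical Γ T →
        ∀ n : ℕ, BassSerre.virtuallyAbelianFamily Γ n ⊆
          BassSerre.isotropyFamily Γ (BassSerre.ConedTree Γ T)) := by
  have hT := S.isTree
  have hI := S.withoutInversions
  have := hT.connected.nonempty
  have : Nonempty (BassSerre.ConedTree Γ T) :=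
    ⟨BassSerre.ConedTree.base (BassSerre.Realization.vertex T (Classical.arbitrary V))⟩
  refine ⟨⟨BassSerre.isFamily_isotropyFamily, BassSerre.ConedTree.isGCWComplex hI,
    BassSerre.stabilizer_mem_isotropyFamily, fun H hH => ?_⟩, ?_⟩
  · obtain ⟨p, hp⟩ := BassSerre.mem_isotropyFamily_iff.1 hH
    exact BassSerre.ConedTree.contractibleSpace_of_fixes_point hT hI hp
  · rintro - n H ⟨r, -, hH⟩
    refine BassSerre.mem_isotropyFamily_iff.2 ?_
    rcases BassSerre.fixes_vertex_or_axis hT hI hH with ⟨x, hx⟩ | ⟨L, hL⟩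
    · refine ⟨BassSerre.ConedTree.base (BassSerre.Realization.vertex T x), fun h hh => ?_⟩
      rw [MulAction.mem_stabilizer_iff, BassSerre.ConedTree.smul_base,
        BassSerre.Realization.smul_vertex, hx h hh]
    · refine ⟨BassSerre.ConedTree.apex L, fun h hh => ?_⟩
      rw [MulAction.mem_stabilizer_iff, BassSerre.ConedTree.smul_apex, hL h hh]
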